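/- Let $X$ be a compact connected Riemann surface with canonical bundle $K$, and let $Q$ be a quiver with finite vertex set $V(Q)$ and edge set $E(Q)$; write $t(a), h(a)$ for the tail and head of an edge $a$. A $\overline{Q}$-bundle $(\mathcal E,\phi,x,y)$ on $X$ (a bundle on the double quiver $\overline Q$) consists of * a holomorphic vector bundle $\mathcal E_v$ on $X$ of finite rank $r_v\ge 0$, for every $v\in V(Q)$; * a smooth $\mathrm{End}(\mathcal E_v)$-valued $(1,0)$-form $\phi_v\in\Omega^{1,0}(X,\mathrm{End}(\mathcal E_v))$, for every $v\in V(Q)$; * for every $a\in E(Q)$ a holomorphic bundle morphism $x_a:\mathcal E_{t(a)}\to\mathcal E_{h(a)}$; * for every $a\in E(Q)$ (i.e. for the reversed edge) a smooth $\mathrm{Hom}(\mathcal E_{h(a)},\mathcal E_{t(a)})$-valued $(1,1)$-form $y_a$ (a Dolbeault representative of an element of $H^1(X,\mathrm{Hom}(\mathcal E_{h(a)},\mathcal E_{t(a)})\otimes K)\cong \mathrm{Hom}(\mathcal E_{t(a)},\mathcal E_{h(a)})^*$). An endomorphism of $(\mathcal E,\phi,x,y)$ is a family $f=(f_v)_{v}$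 of holomorphic bundle endomorphisms $f_v:\mathcal E_v\to\mathcal E_v$ such that $f_v\phi_v=\phi_vf_v$ for all $v$, and $f_{h(a)}x_a=x_af_{t(a)}$, $f_{t(a)}y_a=y_af_{h(a)}$ for all $a$, as identities of forms. The $\overline Q$-bundle is simple if each of its endomorphisms is scalar: there is one $c\in\mathbb C$ with $f_v=c\cdot\mathrm{id}_{\mathcal E_v}$ for all $v$. A $\overline{Q}$-subbundle is a family $\mathcal E'=(\mathcal E'_v)_v$ of holomorphic subbundles $\mathcal E'_v\subseteq\mathcal E_v$ with $\phi_v(\mathcal E'_v)\subseteq\mathcal E'_v\otimes\Lambda^{1,0}$, $x_a(\mathcal E'_{t(a)})\subseteq\mathcal E'_{h(a)}$ and $y_a(\mathcal E'_{h(a)})\subseteq\mathcal E'_{t(a)}\otimes\Lambda^{1,1}$. For real numbers $\sigma_v>0$ and $\tau_v$ ($v\in V(Q)$) let $$\mu_{\sigma,\tau}(\mathcal E')=\frac{\sum_{v}\sigma_v\deg(\mathcal E'_v)+\sum_v\tau_v\operatorname{rk}(\mathcal E'_v)}{\sum_v\operatorname{rk}(\mathcal E'_v)},$$ and call $(\mathcal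 E,\phi,x,y)$ stable (with respect to $\sigma,\tau$) if $\mu_{\sigma,\tau}(\mathcal E')<\mu_{\sigma,\tau}(\mathcal E)$ for every $\overline Q$-subbundle $\mathcal E'$ with $0\ne\mathcal E'\ne\mathcal E$. **Proposition.** For all real $\sigma_v>0$ and $\tau_v$: if $(\mathcal E,\phi,x,y)$ is stable, then it is simple, i.e. its only endomorphisms are the scalar multiples of the identity. -/

import Mathlib

open Bundle Manifold
open scoped Manifold ContDiff Laplacian InnerProductSpace

noncomputable section

namespace QbarBundle

universe u w

/-! ### Complex-analytic and real-smooth structures -/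

/-- A Riemann surface is a smooth real surface. -/
theorem isManifold_real (X : Type*) [TopologicalSpace X] [ChartedSpace ℂ X]
    [IsManifold 𝓘(ℂ, ℂ) ω X] : IsManifold 𝓘(ℝ, ℂ) ∞ X := by
  apply isManifold_of_contDiffOn
  intro e e' he he'
  have h := (contDiffGroupoid ω 𝓘(ℂ, ℂ)).compatible (M := X) he he'
  rw [contDiffGroupoid, mem_groupoid_of_pregroupoid] at h
  exact (ContDiffOn.restrict_scalars ℝ h.1).of_le (by simp)

/-- Complex-analytic maps on a complex manifold are real smooth. -/
theorem contMDiffOn_real {E H M F : Type*} [NormedAddCommGroup E] [NormedSpace ℂ E]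
    [NormedAddCommGroup F] [NormedSpace ℂ F] [TopologicalSpace M]
    [TopologicalSpace H] {I : ModelWithCorners ℂ E H} {J : ModelWithCorners ℝ E H}
    (hIJ : (I : H → E) = J) (hIJ' : (I.symm : E → H) = J.symm) [ChartedSpace H M]
    {f : M → F} {s : Set M} (hf : ContMDiffOn I 𝓘(ℂ, F) ω f s) :
    ContMDiffOn J 𝓘(ℝ, F) ∞ f s := by
  intro x hx
  have h := hf x hx
  rw [contMDiffWithinAt_iff] at h ⊢
  refine ⟨h.1, ?_⟩
  have h2 := (ContDiffWithinAt.restrict_scalars ℝ h.2).of_le (m := ∞) (by simp)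
  simpa [extChartAt, hIJ, hIJ', Function.comp_def] using h2

section Bundle

variable {X : Type u} [TopologicalSpace X] [ChartedSpace ℂ X]

/-- The model for a holomorphic vector bundle of rank `r` over a Riemann surface. -/
abbrev modelC (r : ℕ) := 𝓘(ℂ, ℂ).prod 𝓘(ℂ, Fin r → ℂ)

/-- The same model, regarded over the real numbers. -/
abbrev modelR (r : ℕ) := 𝓘(ℝ, ℂ).prod 𝓘(ℝ, Fin r → ℂ)

/-! ### Morphisms of bundles -/

/-- A family of linear maps between the fibres of two bundles. -/
abbrev FibreMap (E E' : X → Type w) [∀ p, AddCommGroup (E p)] [∀ p, Module ℂ (E p)]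
    [∀ p, AddCommGroup (E' p)] [∀ p, Module ℂ (E' p)] :=
  ∀ p, E p →ₗ[ℂ] E' p

section Morphisms

variable {r r' : ℕ} {E E' : X → Type w}
  [∀ p, AddCommGroup (E p)] [∀ p, Module ℂ (E p)] [∀ p, TopologicalSpace (E p)]
  [TopologicalSpace (TotalSpace (Fin r → ℂ) E)] [FiberBundle (Fin r → ℂ) E]
  [∀ p, AddCommGroup (E' p)] [∀ p, Module ℂ (E' p)] [∀ p, TopologicalSpace (E' p)]
  [TopologicalSpace (TotalSpace (Fin r' → ℂ) E')] [FiberBundle (Fin r' → ℂ) E']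

/-- The map of total spaces defined by a family of linear maps between the fibres. -/
def FibreMap.total (r r' : ℕ) (T : FibreMap E E') :
    TotalSpace (Fin r → ℂ) E → TotalSpace (Fin r' → ℂ) E' :=
  fun e => ⟨e.1, T e.1 e.2⟩

variable (r r') in
/-- `T` is a holomorphic morphism of vector bundles. -/
def IsHolomorphicMap (T : FibreMap E E') : Prop :=
  ContMDiff (modelC r) (modelC r') ω (T.total r r')

variable (r r') in
/-- `T` is a smooth morphism of complex vector bundles over the set `U`. -/
def IsSmoothMapOn (T : FibreMap E E') (U : Set X) : Prop :=
  ContMDiffOn (modelR r) (modelR r') ∞ (T.total r r') {e | e.1 ∈ U}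

variable [IsManifold 𝓘(ℂ, ℂ) ω X]

/-- The holomorphic coordinate vector field `∂/∂z` on the domain of the chart at `c`. -/
def coordField (c q : X) : TangentSpace 𝓘(ℂ, ℂ) q :=
  (trivializationAt ℂ (TangentSpace 𝓘(ℂ, ℂ) : X → Type) c).symm q 1

/-- A family of `Hom(E, E')`-valued `(1,0)`-covectors: at each point a *complex linear* map from the
tangent line to `Hom(E_p, E'_p)`. -/
abbrev OneForm (E E' : X → Type w) [∀ p, AddCommGroup (E p)] [∀ p, Module ℂ (E p)]
    [∀ p, AddCommGroup (E' p)] [∀ p, Module ℂ (E' p)] :=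
  ∀ p : X, TangentSpace 𝓘(ℂ, ℂ) p →ₗ[ℂ] (E p →ₗ[ℂ] E' p)

/-- A family of `Hom(E, E')`-valued `2`-covectors: at each point a real bilinear alternating map on
the tangent line with values in `Hom(E_p, E'_p)`. On a Riemann surface all such forms are
of type `(1,1)`. -/
abbrev TwoForm (E E' : X → Type w) [∀ p, AddCommGroup (E p)] [∀ p, Module ℂ (E p)]
    [∀ p, AddCommGroup (E' p)] [∀ p, Module ℂ (E' p)] :=
  ∀ p : X, TangentSpace 𝓘(ℂ, ℂ) p [⋀^Fin 2]→ₗ[ℝ] (E p →ₗ[ℂ] E' p)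

variable (r r') in
/-- Smoothness of a `(1,0)`-form: in each chart, writing it as `A dz`, the coefficient `A` is a
smooth bundle morphism. -/
def OneForm.IsSmooth (φ : OneForm E E') : Prop :=
  ∀ c : X, IsSmoothMapOn r r' (fun q => φ q (coordField c q)) (chartAt ℂ c).source

variable (r r') in
/-- Smoothness of a `2`-form: in each chart with coordinate `z = s + i t`, writing it as `B ds ∧ dt`,
the coefficient `B` is a smooth bundle morphism. -/
def TwoForm.IsSmooth (y : TwoForm E E') : Prop :=
  ∀ c : X, IsSmoothMapOn r r'
    (fun q => y q ![coordField c q, Complex.I • coordField c q]) (chartAt ℂ c).source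

end Morphisms

/-! ### Hermitian metrics, holomorphic subbundles and their degree -/

section Degree

variable {r : ℕ} {E : X → Type w}
  [∀ p, AddCommGroup (E p)] [∀ p, Module ℂ (E p)] [∀ p, TopologicalSpace (E p)]
  [TopologicalSpace (TotalSpace (Fin r → ℂ) E)] [FiberBundle (Fin r → ℂ) E]

variable (r E) in
/-- A smooth hermitian metric on a complex vector bundle: a hermitian inner product on every fibre,
whose associated squared norm is a smooth function on the total space. -/
structure HermitianMetric where
  /-- the inner product on the fibre over `p` -/
  core : ∀ p, InnerProductSpace.Core ℂ (E p)
  smooth : ContMDiff (modelR r) 𝓘(ℝ, ℝ) ∞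
    (fun e : TotalSpace (Fin r → ℂ) E => ((core e.1).inner e.2 e.2).re)

variable (r) in
/-- The section `s` of `E` is holomorphic on `U`. -/
def IsHolomorphicSectionOn (s : ∀ p, E p) (U : Set X) : Prop :=
  ContMDiffOn 𝓘(ℂ, ℂ) (modelC r) ω (fun q => (⟨q, s q⟩ : TotalSpace (Fin r → ℂ) E)) U

variable (r) in
/-- `s₁, …, s_k` is a holomorphic frame, over the open set `U`, of the family of subspaces `S`. -/
structure IsHolomorphicFrameOn {k : ℕ} (S : ∀ p, Submodule ℂ (E p)) (s : Fin k → ∀ p, E p)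
    (U : Set X) : Prop where
  isOpen : IsOpen U
  holomorphic : ∀ a, IsHolomorphicSectionOn r (s a) U
  linearIndependent : ∀ q ∈ U, LinearIndependent ℂ (fun a => s a q)
  span_eq : ∀ q ∈ U, Submodule.span ℂ (Set.range fun a => s a q) = S q

variable (r E) in
/-- A holomorphic subbundle of `E`: a family of subspaces of the fibres, of constant dimension,
which is locally spanned by a holomorphic frame. -/
structure HolomorphicSubbundle where
  /-- the fibre of the subbundle over `p` -/
  fibre : ∀ p, Submodule ℂ (E p)
  /-- the rank of the subbundle -/
  rank : ℕ
  exists_frame : ∀ p, ∃ (U : Set X) (s : Fin rank → ∀ q, E q),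
    p ∈ U ∧ IsHolomorphicFrameOn r fibre s U

variable (r E) in
/-- A holomorphic vector bundle as a subbundle of itself. -/
def HolomorphicSubbundle.whole [VectorBundle ℂ (Fin r → ℂ) E]
    [ContMDiffVectorBundle ω (Fin r → ℂ) E 𝓘(ℂ, ℂ)] : HolomorphicSubbundle r E where
  fibre := fun _ => ⊤
  rank := r
  exists_frame := fun p => by
    let e := trivializationAt (Fin r → ℂ) E p
    let b := Pi.basisFun ℂ (Fin r)
    have h := e.isLocalFrameOn_localFrame_baseSet 𝓘(ℂ, ℂ) ω b
    exact ⟨e.baseSet, e.localFrame b, mem_baseSet_trivializationAt _ _ _, e.open_baseSet,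
      h.contMDiffOn, fun q hq => h.linearIndependent hq,
      fun q hq => top_le_iff.1 (h.generating hq)⟩

/-- A holomorphic frame of the subbundle near the point `p`. -/
def HolomorphicSubbundle.frame (S : HolomorphicSubbundle r E) (p : X) :
    Fin S.rank → ∀ q, E q :=
  (S.exists_frame p).choose_spec.choose

/-- For sections `s₁, …, s_k` of `E`, the function `log det (⟨s_a, s_b⟩)`. -/
def HermitianMetric.logGram (H : HermitianMetric r E) {k : ℕ} (s : Fin k → ∀ q, E q) (q : X) : ℝ :=
  Real.log (Matrix.det (Matrix.of fun a b => (H.core q).inner (s a q) (s b q))).re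

/-- Let `S` carry the metric induced by `H`, and let `F` be the curvature of its Chern connection.
If `s` is a local holomorphic frame of `S`, then `tr F = ∂̄∂ log det (⟨s_a, s_b⟩)`. Hence
in a holomorphic chart with coordinate `z = s + i t` the Chern form `(i / 2π) tr F` is the `2`-form
`-(1 / 4π) Δ (log det (⟨s_a, s_b⟩)) ds ∧ dt`, which does not depend on the frame. This is
its coefficient in the chart at `c`, at the point with coordinate `z`. -/
def HermitianMetric.chernDensity (H : HermitianMetric r E) (S : HolomorphicSubbundle r E) (c : X)
    (z : ℂ) : ℝ :=
  -(1 / (4 * Real.pi)) *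
    (Δ (fun z' : ℂ => H.logGram (S.frame ((chartAt ℂ c).symm z)) ((chartAt ℂ c).symm z'))) z

section Existence

variable [VectorBundle ℂ (Fin r → ℂ) E] [ContMDiffVectorBundle ω (Fin r → ℂ) E 𝓘(ℂ, ℂ)]
  [IsManifold 𝓘(ℂ, ℂ) ω X] [CompactSpace X] [T2Space X]

variable (X) in
theorem exists_partition : ∃ f : SmoothPartitionOfUnity X 𝓘(ℝ, ℂ) X Set.univ,
    f.IsSubordinate (fun x => (chartAt ℂ x).source) :=
  have := isManifold_real X
  SmoothPartitionOfUnity.exists_isSubordinate_chartAt_source 𝓘(ℝ, ℂ) X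

variable (X) in
/-- A smooth partition of unity on the compact Riemann surface `X` subordinate to its charts. -/
def partition : SmoothPartitionOfUnity X 𝓘(ℝ, ℂ) X Set.univ := (exists_partition X).choose

/-- The integral over `X` of a `2`-form, given by its coefficients `f c` in the charts at the
points `c` of `X`. -/
def surfaceIntegral (f : X → ℂ → ℝ) : ℝ :=
  ∑ᶠ c : X, ∫ z in (chartAt ℂ c).target, partition X c ((chartAt ℂ c).symm z) * f c z

variable (r E) in
/-- Every holomorphic vector bundle on a compact Riemann surface has a hermitian metric. -/
theorem nonempty_hermitianMetric : Nonempty (HermitianMetric r E) := by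
  classical
  have := isManifold_real X
  let τ : X → Trivialization (Fin r → ℂ) (π (Fin r → ℂ) E) :=
    fun i => trivializationAt (Fin r → ℂ) E i
  obtain ⟨f, hf⟩ := SmoothPartitionOfUnity.exists_isSubordinate 𝓘(ℝ, ℂ) (s := (Set.univ : Set X))
    isClosed_univ (fun i => (τ i).baseSet) (fun i => (τ i).open_baseSet)
    (fun x _ => Set.mem_iUnion_of_mem x (mem_baseSet_trivializationAt _ _ _))
  have hfin : {i | (Function.support (f i)).Nonempty}.Finite :=
    f.locallyFinite.finite_nonempty_of_compact
  let I : Finset X := hfin.toFinset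
  have hpos : ∀ p, ∃ i ∈ I, 0 < f i p := by
    intro p
    obtain ⟨i, hi⟩ := f.exists_pos_of_mem (Set.mem_univ p)
    exact ⟨i, hfin.mem_toFinset.2 ⟨p, hi.ne'⟩, hi⟩
  let g : ∀ (i p : X), E p → Fin r → ℂ := fun i p => (τ i).linearMapAt ℂ p
  let h : ∀ p, E p → E p → ℂ :=
    fun p u v => ∑ i ∈ I, (f i p : ℂ) * ∑ k, (starRingEnd ℂ) (g i p u k) * g i p v k
  have hre : ∀ p u, (h p u u).re = ∑ i ∈ I, f i p * ∑ k, Complex.normSq (g i p u k) := by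
    intro p u
    simp only [h, Complex.re_sum, ← Complex.normSq_eq_conj_mul_self, ← Complex.ofReal_sum,
      Complex.re_ofReal_mul, Complex.ofReal_re]
  have hnn : ∀ p u i, 0 ≤ f i p * ∑ k, Complex.normSq (g i p u k) := fun p u i =>
    mul_nonneg (f.nonneg i p) (Finset.sum_nonneg fun k _ => Complex.normSq_nonneg _)
  refine ⟨⟨fun p =>
    { inner := h p
      conj_inner_symm := ?_
      re_inner_nonneg := ?_
      add_left := ?_
      smul_left := ?_
      definite := ?_ }, ?_⟩⟩
  · intro u v
    simp only [h, map_sum, map_mul, Complex.conj_ofReal, Complex.conj_conj]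
    exact Finset.sum_congr rfl fun i _ => by
      congr 1
      exact Finset.sum_congr rfl fun k _ => mul_comm _ _
  · intro u
    change 0 ≤ (h p u u).re
    rw [hre]
    exact Finset.sum_nonneg fun i _ => hnn p u i
  · intro u v z
    simp only [h, g, map_add, Pi.add_apply, add_mul, Finset.sum_add_distrib, mul_add]
  · intro u v c
    simp only [h, g, map_smul, Pi.smul_apply, smul_eq_mul, map_mul, Finset.mul_sum]
    exact Finset.sum_congr rfl fun i _ => Finset.sum_congr rfl fun k _ => by ring
  · intro u hu
    have hu' : (h p u u).re = 0 := by
      change h p u u = 0 at hu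
      rw [hu]; rfl
    rw [hre, Finset.sum_eq_zero_iff_of_nonneg fun i _ => hnn p u i] at hu'
    obtain ⟨i, hi, hip⟩ := hpos p
    have h1 := (mul_eq_zero.1 (hu' i hi)).resolve_left hip.ne'
    rw [Finset.sum_eq_zero_iff_of_nonneg fun k _ => Complex.normSq_nonneg _] at h1
    have hb : p ∈ (τ i).baseSet := hf i (subset_tsupport _ hip.ne')
    have h2 : g i p u = 0 := funext fun k => Complex.normSq_eq_zero.1 (h1 k (Finset.mem_univ k))
    have h3 : (τ i).linearEquivAt ℂ p hb u = 0 := by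
      rw [← h2]
      simp only [g, (τ i).coe_linearMapAt_of_mem hb]
      rfl
    exact ((τ i).linearEquivAt ℂ p hb).map_eq_zero_iff.1 h3
  · change ContMDiff (modelR r) 𝓘(ℝ, ℝ) ∞
      (fun e : TotalSpace (Fin r → ℂ) E => (h e.1 e.2 e.2).re)
    simp only [hre]
    refine contMDiff_finsetSum fun i _ => ?_
    intro e
    by_cases he : e.1 ∈ tsupport (f i)
    · have hb : e.1 ∈ (τ i).baseSet := hf i he
      have hs : (τ i).source ∈ nhds e := (τ i).open_source.mem_nhds ((τ i).mem_source.2 hb)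
      have h1 : ContMDiffOn (modelC r) 𝓘(ℂ, Fin r → ℂ) ω
          (fun e : TotalSpace (Fin r → ℂ) E => (τ i e).2) (τ i).source :=
        contMDiff_snd.comp_contMDiffOn ((τ i).contMDiffOn (IB := 𝓘(ℂ, ℂ)) (n := ω))
      have h2 : ContMDiffAt (modelR r) 𝓘(ℝ, Fin r → ℂ) ∞
          (fun e : TotalSpace (Fin r → ℂ) E => (τ i e).2) e :=
        (contMDiffOn_real (J := modelR r) rfl rfl h1).contMDiffAt hs
      have h3 : ContMDiffAt (modelR r) 𝓘(ℝ, ℝ) ∞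
          (fun e : TotalSpace (Fin r → ℂ) E => ∑ k, Complex.normSq ((τ i e).2 k)) e := by
        have hc : ContDiff ℝ ∞ (fun w : Fin r → ℂ => ∑ k, Complex.normSq (w k)) := by
          simp only [Complex.normSq_eq_norm_sq]
          exact ContDiff.sum fun k _ => (contDiff_apply ℝ ℂ k).norm_sq ℝ
        exact hc.contMDiff.contMDiffAt.comp e h2
      have h4 : ContMDiffAt (modelR r) 𝓘(ℝ, ℝ) ∞
          (fun e : TotalSpace (Fin r → ℂ) E => f i e.1) e :=
        ((f i).contMDiff.comp (contMDiff_proj E)).contMDiffAt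
      refine (h4.mul h3).congr_of_eventuallyEq ?_
      filter_upwards [hs] with e' he'
      have hb' := (τ i).mem_source.1 he'
      simp only [g, (τ i).coe_linearMapAt_of_mem hb', Pi.mul_apply]
    · have hz : ∀ᶠ e' : TotalSpace (Fin r → ℂ) E in nhds e, e'.1 ∉ tsupport (f i) :=
        (FiberBundle.continuous_proj (Fin r → ℂ) E).continuousAt.eventually
          ((isClosed_tsupport _).isOpen_compl.mem_nhds he)
      refine (contMDiffAt_const (c := (0 : ℝ))).congr_of_eventuallyEq ?_
      filter_upwards [hz] with e' he'
      simp [image_eq_zero_of_notMem_tsupport he']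

/-- The degree of a holomorphic subbundle: the integral over `X` of its first Chern form
`(i / 2π) tr F`. It does not depend on the metric. -/
def HolomorphicSubbundle.degree (S : HolomorphicSubbundle r E) : ℝ :=
  surfaceIntegral ((nonempty_hermitianMetric r E).some.chernDensity S)

end Existence

end Degree

end Bundle

/-! ### Bundles on double quivers -/

section Quiver

variable {X : Type u} [TopologicalSpace X] [ChartedSpace ℂ X] [IsManifold 𝓘(ℂ, ℂ) ω X]
  {V : Type*} [Quiver V]

section Defs

variable (r : V → ℕ) (E : V → X → Type w)
  [∀ v p, AddCommGroup (E v p)] [∀ v p, Module ℂ (E v p)] [∀ v p, TopologicalSpace (E v p)]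
  [∀ v, TopologicalSpace (TotalSpace (Fin (r v) → ℂ) (E v))]
  [∀ v, FiberBundle (Fin (r v) → ℂ) (E v)]

/-- The data `(φ, x, y)` making the family of holomorphic vector bundles `E v` into a bundle on the
double of the quiver `V`: smooth `End(E_v)`-valued `(1,0)`-forms `φ_v`; for every arrow
`a : i ⟶ j` a holomorphic morphism `x_a : E_i → E_j`; and for its reverse a smooth
`Hom(E_j, E_i)`-valued `(1,1)`-form `y_a`. -/
structure Rep where
  φ : ∀ v, OneForm (E v) (E v)
  φ_smooth : ∀ v, (φ v).IsSmooth (r v) (r v)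
  x : ∀ {i j : V}, (i ⟶ j) → FibreMap (E i) (E j)
  x_holomorphic : ∀ {i j : V} (a : i ⟶ j), IsHolomorphicMap (r i) (r j) (x a)
  y : ∀ {i j : V}, (i ⟶ j) → TwoForm (E j) (E i)
  y_smooth : ∀ {i j : V} (a : i ⟶ j), (y a).IsSmooth (r j) (r i)

end Defs

variable {r r' : V → ℕ} {E E' : V → X → Type w}
  [∀ v p, AddCommGroup (E v p)] [∀ v p, Module ℂ (E v p)] [∀ v p, TopologicalSpace (E v p)]
  [∀ v, TopologicalSpace (TotalSpace (Fin (r v) → ℂ) (E v))]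
  [∀ v, FiberBundle (Fin (r v) → ℂ) (E v)]
  [∀ v p, AddCommGroup (E' v p)] [∀ v p, Module ℂ (E' v p)] [∀ v p, TopologicalSpace (E' v p)]
  [∀ v, TopologicalSpace (TotalSpace (Fin (r' v) → ℂ) (E' v))]
  [∀ v, FiberBundle (Fin (r' v) → ℂ) (E' v)]

/-- A morphism of bundles on the double quiver: a family of holomorphic bundle morphisms commuting
with `φ`, `x` and `y`. -/
structure IsMorphism (R : Rep r E) (R' : Rep r' E') (f : ∀ v, FibreMap (E v) (E' v)) : Prop where
  holomorphic : ∀ v, IsHolomorphicMap (r v) (r' v) (f v)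
  comm_φ : ∀ v p (t : TangentSpace 𝓘(ℂ, ℂ) p), f v p ∘ₗ R.φ v p t = R'.φ v p t ∘ₗ f v p
  comm_x : ∀ {i j : V} (a : i ⟶ j) p, f j p ∘ₗ R.x a p = R'.x a p ∘ₗ f i p
  comm_y : ∀ {i j : V} (a : i ⟶ j) p (t : Fin 2 → TangentSpace 𝓘(ℂ, ℂ) p),
    f i p ∘ₗ R.y a p t = R'.y a p t ∘ₗ f j p

/-- `R` is simple: its only endomorphisms are the scalar multiples of the identity. -/
def Rep.IsSimple (R : Rep r E) : Prop :=
  ∀ f : ∀ v, FibreMap (E v) (E v), IsMorphism R R f →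
    ∃ c : ℂ, ∀ v p, f v p = c • (LinearMap.id : E v p →ₗ[ℂ] E v p)

/-- The holomorphic subbundles `S_v ⊆ E_v` form a subbundle on the double quiver: `φ`, `x` and `y`
restrict to them. -/
structure Rep.IsSubbundle (R : Rep r E) (S : ∀ v, HolomorphicSubbundle (r v) (E v)) : Prop where
  map_φ : ∀ v p (t : TangentSpace 𝓘(ℂ, ℂ) p), (S v).fibre p ≤ ((S v).fibre p).comap (R.φ v p t)
  map_x : ∀ {i j : V} (a : i ⟶ j) p, (S i).fibre p ≤ ((S j).fibre p).comap (R.x a p)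
  map_y : ∀ {i j : V} (a : i ⟶ j) p (t : Fin 2 → TangentSpace 𝓘(ℂ, ℂ) p),
    (S j).fibre p ≤ ((S i).fibre p).comap (R.y a p t)

variable [Fintype V] [∀ v, VectorBundle ℂ (Fin (r v) → ℂ) (E v)]
  [∀ v, ContMDiffVectorBundle ω (Fin (r v) → ℂ) (E v) 𝓘(ℂ, ℂ)] [CompactSpace X] [T2Space X]

/-- The `(σ, τ)`-slope `(∑ σ_v deg S_v + ∑ τ_v rk S_v) / ∑ rk S_v`. -/
def slope (σ τ : V → ℝ) (S : ∀ v, HolomorphicSubbundle (r v) (E v)) : ℝ :=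
  (∑ v, σ v * (S v).degree + ∑ v, τ v * ((S v).rank : ℝ)) / ∑ v, ((S v).rank : ℝ)

/-- `R` is `(σ, τ)`-stable: every nonzero proper subbundle has slope less than that of the bundle. -/
def Rep.IsStable (R : Rep r E) (σ τ : V → ℝ) : Prop :=
  ∀ S : ∀ v, HolomorphicSubbundle (r v) (E v), R.IsSubbundle S →
    (∃ v p, (S v).fibre p ≠ ⊥) → (∃ v p, (S v).fibre p ≠ ⊤) →
      slope σ τ S < slope σ τ (fun v => HolomorphicSubbundle.whole (r v) (E v))

end Quiver

end QbarBundle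

end

/-!
Let `f` be an endomorphism of a stable bundle. At a vertex with `E v ≠ 0` the functions
`det (f v - c)` are holomorphic on the compact connected surface, hence constant, so an eigenvalue
`c` of `f v` at one point is an eigenvalue at every point. Put `g = f - c`. The local Smith normal
form of a holomorphic family of matrices in one variable shows that the kernel and the image of `g`
extend over the isolated points where the rank drops to holomorphic subbundles `S` and `I`; by
continuity these are preserved by `φ`, `x` and `y`.

The ranks of `S` and `I` add up to that of `E`. To see that `deg E ≤ deg S + deg I`, let `u` be the
squared norm of the map `det (E / S) → det I` induced by `g`, a smooth nonnegative function with
isolated zeros. Off these zeros the Chern form of `S` plus that of `I` minus that of `E` is a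
negative multiple of `Δ log u`; as `log` is concave, the Laplacian of `log (u + ε)` is at least
`u / (u + ε)` times that of `log u`, it has integral zero, and `ε → 0` gives the inequality. Hence
the slope of `E` is at most the larger of the slopes of `S` and `I`. As `S ≠ 0`, stability forces
`I = 0`, that is `f = c`.
-/

open Filter Topology MeasureTheory
open scoped ComplexOrder

noncomputable section

namespace QbarBundle

/-! ### The Laplacian -/

section Laplacian

variable {E F : Type*} [NormedAddCommGroup E] [NormedAddCommGroup F] [NormedSpace ℝ F]

section SecondDerivative

variable [NormedSpace ℝ E] {f : E → F} {x : E}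

theorem fderiv_fderiv_apply_const (hf : DifferentiableAt ℝ (fderiv ℝ f) x) (v : E) :
    fderiv ℝ (fun y => fderiv ℝ f y v) x = (fderiv ℝ (fderiv ℝ f) x).flip v := by
  ext w
  rw [fderiv_clm_apply hf (differentiableAt_const v)]
  simp

theorem deriv_deriv_nonneg_of_isLocalMin {g : ℝ → ℝ} {t : ℝ} (hg : ContinuousAt g t)
    (hmin : IsLocalMin g t) : 0 ≤ deriv (deriv g) t := by
  by_contra! hneg
  have hmax := isLocalMax_of_deriv_deriv_neg hneg hmin.deriv_eq_zero hg
  have hconst : g =ᶠ[𝓝 t] fun _ => g t := by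
    filter_upwards [hmin, hmax] with s hle hge using le_antisymm hge hle
  have hzero : deriv (deriv g) t = 0 := by
    rw [hconst.deriv.deriv_eq, deriv_const', deriv_const]
  exact hneg.ne hzero

theorem deriv_deriv_comp_add_smul (hf : ContDiffAt ℝ 2 f x) (v : E) :
    deriv (deriv fun t : ℝ => f (x + t • v)) 0 = fderiv ℝ (fderiv ℝ f) x v v := by
  have hline (t : ℝ) : HasDerivAt (fun t : ℝ => x + t • v) v t := by
    simpa using ((hasDerivAt_id t).smul_const v).const_add x
  have hzero : x + (0 : ℝ) • v = x := by simp
  have hderiv : (deriv fun t : ℝ => f (x + t • v)) =ᶠ[𝓝 0]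
      fun t => fderiv ℝ f (x + t • v) v := by
    have hnear : ∀ᶠ y in 𝓝 (x + (0 : ℝ) • v), ContDiffAt ℝ 2 f y := by
      rw [hzero]
      exact hf.eventually (by simp)
    filter_upwards [(hline 0).continuousAt.eventually hnear] with t ht
    exact ((ht.differentiableAt (by simp)).hasFDerivAt.comp_hasDerivAt t (hline t)).deriv
  have hf' : HasFDerivAt (fderiv ℝ f) (fderiv ℝ (fderiv ℝ f) x) (x + (0 : ℝ) • v) := by
    rw [hzero]
    exact ((hf.fderiv_right (m := 1) (by norm_num)).differentiableAt (by simp)).hasFDerivAt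
  have hsecond : HasDerivAt (fun t : ℝ => fderiv ℝ f (x + t • v) v)
      (fderiv ℝ (fderiv ℝ f) x v v) 0 := by
    have hfirst : HasDerivAt (fun t : ℝ => fderiv ℝ f (x + t • v)) (fderiv ℝ (fderiv ℝ f) x v) 0 :=
      HasFDerivAt.comp_hasDerivAt (f := fun t : ℝ => x + t • v) 0 hf' (hline 0)
    simpa only [map_zero, add_zero] using hfirst.clm_apply (hasDerivAt_const (0 : ℝ) v)
  rw [hderiv.deriv_eq, hsecond.deriv]

theorem fderiv_fderiv_apply_self_nonneg_of_isLocalMin {f : E → ℝ} {x : E}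
    (hf : ContDiffAt ℝ 2 f x) (hmin : IsLocalMin f x) (v : E) :
    0 ≤ fderiv ℝ (fderiv ℝ f) x v v := by
  have hline : Tendsto (fun t : ℝ => x + t • v) (𝓝 0) (𝓝 x) := by
    have : ContinuousAt (fun t : ℝ => x + t • v) 0 := by fun_prop
    simpa [ContinuousAt] using this
  rw [← deriv_deriv_comp_add_smul hf]
  refine deriv_deriv_nonneg_of_isLocalMin ?_ ?_
  · simpa [ContinuousAt, Function.comp_def] using hf.continuousAt.tendsto.comp hline
  · simpa [IsLocalMin, IsMinFilter] using hline.eventually hmin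

variable [FiniteDimensional ℝ E] [MeasurableSpace E] [BorelSpace E]

theorem integral_fderiv_apply_eq_zero {μ : Measure E} [μ.IsAddHaarMeasure]
    (hf : ContDiff ℝ 1 f) (hsupp : HasCompactSupport f) (v : E) :
    ∫ x, fderiv ℝ f x v ∂μ = 0 := by
  have hf' : Continuous fun x => fderiv ℝ f x v := by
    have := hf.continuous_fderiv (by simp)
    fun_prop
  have hint : Integrable (fun x => fderiv ℝ f x v) μ :=
    hf'.integrable_of_hasCompactSupport (hsupp.fderiv_apply ℝ v)
  have hint' : Integrable f μ := hf.continuous.integrable_of_hasCompactSupport hsupp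
  simpa using integral_smul_fderiv_eq_neg_fderiv_smul_of_integrable (μ := μ) (𝕜 := ℝ)
    (f := fun _ => (1 : ℝ)) (g := f) (v := v) (by simp) (by simpa using hint)
    (by simpa using hint') (fun _ _ => differentiableAt_const _)
    (fun x _ => hf.differentiable (by simp) x)

end SecondDerivative

variable [InnerProductSpace ℝ E] [FiniteDimensional ℝ E] {f : E → F} {x : E}

theorem laplacian_eq_sum_fderiv_fderiv (f : E → F) (x : E) :
    Δ f x = ∑ i, fderiv ℝ (fderiv ℝ f) x (stdOrthonormalBasis ℝ E i)
      (stdOrthonormalBasis ℝ E i) := by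
  simp [InnerProductSpace.laplacian_eq_iteratedFDeriv_stdOrthonormalBasis,
    iteratedFDeriv_two_apply]

theorem continuousAt_laplacian (hf : ContDiffAt ℝ 2 f x) : ContinuousAt (Δ f) x := by
  have hf'' : ContinuousAt (fderiv ℝ (fderiv ℝ f)) x :=
    ((hf.fderiv_right (m := 1) (by norm_num)).fderiv_right (m := 0) (by norm_num)).continuousAt
  rw [funext (laplacian_eq_sum_fderiv_fderiv f)]
  fun_prop

theorem laplacian_nonneg_of_isLocalMin {f : E → ℝ} {x : E} (hf : ContDiffAt ℝ 2 f x)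
    (hmin : IsLocalMin f x) : 0 ≤ Δ f x := by
  rw [laplacian_eq_sum_fderiv_fderiv]
  exact Finset.sum_nonneg fun i _ => fderiv_fderiv_apply_self_nonneg_of_isLocalMin hf hmin _

theorem integral_laplacian_eq_zero [MeasurableSpace E] [BorelSpace E]
    (hf : ContDiff ℝ 2 f) (hsupp : HasCompactSupport f) : ∫ x, Δ f x = 0 := by
  have hf' : ContDiff ℝ 1 (fderiv ℝ f) := hf.fderiv_right (by norm_num)
  have hpartial (v : E) : ContDiff ℝ 1 (fun x => fderiv ℝ f x v) := hf'.clm_apply contDiff_const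
  have hsupp' (v : E) : HasCompactSupport (fun x => fderiv ℝ f x v) := hsupp.fderiv_apply ℝ v
  have hsecond (v x : E) :
      fderiv ℝ (fderiv ℝ f) x v v = fderiv ℝ (fun y => fderiv ℝ f y v) x v := by
    rw [fderiv_fderiv_apply_const (hf'.differentiable (by simp) x)]
    rfl
  simp only [laplacian_eq_sum_fderiv_fderiv, hsecond]
  rw [integral_finsetSum _ fun i _ => ?_]
  · exact Finset.sum_eq_zero fun i _ => integral_fderiv_apply_eq_zero (hpartial _) (hsupp' _) _
  · have := (hpartial (stdOrthonormalBasis ℝ E i)).continuous_fderiv (by simp)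
    exact Continuous.integrable_of_hasCompactSupport (by fun_prop) ((hsupp' _).fderiv_apply ℝ _)

theorem laplacian_finset_sum {ι : Type*} (s : Finset ι) {f : ι → E → F}
    (hf : ∀ i ∈ s, ContDiffAt ℝ 2 (f i) x) : Δ (∑ i ∈ s, f i) x = ∑ i ∈ s, Δ (f i) x := by
  classical
  induction s using Finset.induction_on with
  | empty =>
    rw [Finset.sum_empty, Finset.sum_empty]
    exact congrFun InnerProductSpace.laplacian_const x
  | insert a s ha ih =>
    have hs : ContDiffAt ℝ 2 (∑ i ∈ s, f i) x := by
      simpa only [← Finset.sum_fn] using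
        ContDiffAt.sum fun i hi => hf i (Finset.mem_insert_of_mem hi)
    rw [Finset.sum_insert ha, Finset.sum_insert ha,
      (hf a (Finset.mem_insert_self _ _)).laplacian_add hs,
      ih fun i hi => hf i (Finset.mem_insert_of_mem hi)]

theorem laplacian_eq_zero_of_eventuallyEq_zero (hf : f =ᶠ[𝓝 x] 0) : Δ f x = 0 :=
  (InnerProductSpace.laplacian_congr_nhds hf).eq_of_nhds.trans
    (congrFun InnerProductSpace.laplacian_const x)

theorem setIntegral_laplacian_eq_zero [MeasurableSpace E] [BorelSpace E] {T K : Set E}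
    (hT : IsOpen T) (hK : IsCompact K) (hKT : K ⊆ T) (hf : ∀ x ∈ T, ContDiffAt ℝ 2 f x)
    (hf₀ : ∀ x ∈ T \ K, f x = 0) : ∫ x in T, Δ f x = 0 := by
  let g : E → F := T.indicator f
  have g_eq (x : E) (hx : x ∈ T) : g =ᶠ[𝓝 x] f := by
    filter_upwards [hT.mem_nhds hx] with y hy using Set.indicator_of_mem hy _
  have g_eq_zero (x : E) (hx : x ∉ K) : g x = 0 := by
    by_cases hxT : x ∈ T
    · exact (Set.indicator_of_mem hxT f).trans (hf₀ x ⟨hxT, hx⟩)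
    · exact Set.indicator_of_notMem hxT f
  have g_eventuallyEq_zero (x : E) (hx : x ∉ K) : g =ᶠ[𝓝 x] 0 := by
    filter_upwards [hK.isClosed.isOpen_compl.mem_nhds hx] with y hy using g_eq_zero y hy
  have g_contDiff : ContDiff ℝ 2 g := contDiff_iff_contDiffAt.2 fun x => by
    by_cases hx : x ∈ K
    · exact (hf x (hKT hx)).congr_of_eventuallyEq (g_eq x (hKT hx))
    · exact contDiffAt_const.congr_of_eventuallyEq (g_eventuallyEq_zero x hx)
  calc ∫ x in T, Δ f x = ∫ x in T, Δ g x := setIntegral_congr_fun hT.measurableSet fun x hx =>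
        (InnerProductSpace.laplacian_congr_nhds (g_eq x hx)).eq_of_nhds.symm
    _ = ∫ x, Δ g x := setIntegral_eq_integral_of_forall_compl_eq_zero fun x hx =>
        laplacian_eq_zero_of_eventuallyEq_zero (g_eventuallyEq_zero x fun h => hx (hKT h))
    _ = 0 := integral_laplacian_eq_zero g_contDiff (.intro hK g_eq_zero)

theorem log_add_sub_log_add_ge {a b ε : ℝ} (ha : 0 < a) (hb : 0 < b) (hε : 0 < ε) :
    a / (a + ε) * (Real.log b - Real.log a) ≤ Real.log (b + ε) - Real.log (a + ε) := by
  have haε : 0 < a + ε := by positivity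
  have hconcave := strictConcaveOn_log_Ioi.concaveOn.2
    (Set.mem_Ioi.2 (div_pos hb ha)) (Set.mem_Ioi.2 one_pos)
    (show 0 ≤ a / (a + ε) by positivity) (show 0 ≤ ε / (a + ε) by positivity) (by field_simp)
  have hcomb : a / (a + ε) * (b / a) + ε / (a + ε) * 1 = (b + ε) / (a + ε) := by field_simp
  simp only [smul_eq_mul, Real.log_one, mul_zero, add_zero] at hconcave
  rwa [hcomb, Real.log_div hb.ne' ha.ne', Real.log_div (by positivity) haε.ne'] at hconcave

theorem laplacian_log_add_ge {u : E → ℝ} {x : E} {ε : ℝ} (hε : 0 < ε) (hu : ContDiffAt ℝ 2 u x)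
    (hpos : 0 < u x) :
    u x / (u x + ε) * Δ (fun y => Real.log (u y)) x ≤ Δ (fun y => Real.log (u y + ε)) x := by
  have hlog : ContDiffAt ℝ 2 (fun y => Real.log (u y)) x := hu.log hpos.ne'
  have hlogε : ContDiffAt ℝ 2 (fun y => Real.log (u y + ε)) x :=
    (hu.add contDiffAt_const).log (by positivity)
  have hscaled : ContDiffAt ℝ 2 ((u x / (u x + ε)) • fun y => Real.log (u y)) x :=
    contDiffAt_const.smul hlog
  -- This is the concavity of `log`, and it is why the regularisation `log (u + ε)` is chosen.
  have hmin : IsLocalMin ((fun y => Real.log (u y + ε)) -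
      (u x / (u x + ε)) • fun y => Real.log (u y)) x := by
    filter_upwards [hu.continuousAt.eventually (lt_mem_nhds hpos)] with y hy
    have := log_add_sub_log_add_ge hpos hy hε
    simp only [Pi.sub_apply, Pi.smul_apply, smul_eq_mul]
    linarith
  rw [← sub_nonneg, ← smul_eq_mul, ← InnerProductSpace.laplacian_smul _ hlog,
    ← hlogε.laplacian_sub hscaled]
  exact laplacian_nonneg_of_isLocalMin (hlogε.sub hscaled) hmin

theorem neg_mul_laplacian_log_add_le {u : E → ℝ} {x : E} {ε a d : ℝ} (hε : 0 < ε) (ha : 0 ≤ a)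
    (hu : ContDiffAt ℝ 2 u x) (hu₀ : ∀ y, 0 ≤ u y)
    (hd : 0 < u x → d = -a * Δ (fun y => Real.log (u y)) x) :
    -a * Δ (fun y => Real.log (u y + ε)) x ≤ u x / (u x + ε) * d := by
  obtain hpos | hzero := (hu₀ x).lt_or_eq
  · rw [hd hpos, mul_left_comm, neg_mul, neg_mul, neg_le_neg_iff]
    exact mul_le_mul_of_nonneg_left (laplacian_log_add_ge hε hu hpos) ha
  · have hlog : ContDiffAt ℝ 2 (fun y => Real.log (u y + ε)) x :=
      (hu.add contDiffAt_const).log (by rw [← hzero]; positivity)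
    have hmin : IsLocalMin (fun y => Real.log (u y + ε)) x := Eventually.of_forall fun y =>
      Real.log_le_log (by rw [← hzero]; positivity) (by linarith [hu₀ y])
    rw [← hzero, zero_div, zero_mul, neg_mul, neg_nonpos]
    exact mul_nonneg ha (laplacian_nonneg_of_isLocalMin hlog hmin)

theorem laplacian_add_harmonicAt {g : E → F} (hf : ContDiffAt ℝ 2 f x)
    (hg : InnerProductSpace.HarmonicAt g x) : Δ (fun y => f y + g y) x = Δ f x := by
  have hsum := hf.laplacian_add hg.1
  rw [hg.2.eq_of_nhds] at hsum
  exact hsum.trans (add_zero _)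

end Laplacian

section ComplexPlane

variable {F : Type*} [NormedAddCommGroup F] [NormedSpace ℝ F]

theorem fderiv_real_eq_deriv_mul {h : ℂ → ℂ} {z : ℂ} (hh : DifferentiableAt ℂ h z) (v : ℂ) :
    fderiv ℝ h z v = deriv h z * v := by
  rw [hh.fderiv_restrictScalars ℝ]
  simp [mul_comm]

theorem det_fderiv_real_eq_sq_norm_deriv {h : ℂ → ℂ} {z : ℂ} (hh : DifferentiableAt ℂ h z) :
    (fderiv ℝ h z).det = ‖deriv h z‖ ^ 2 := by
  have hdet := LinearMap.det_restrictScalars (R := ℝ) (f := (fderiv ℂ h z : ℂ →ₗ[ℂ] ℂ))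
  rw [hh.fderiv_restrictScalars ℝ, ContinuousLinearMap.det]
  simpa [Algebra.norm_complex_eq, Complex.normSq_eq_norm_sq] using hdet

theorem fderiv_fderiv_comp_holomorphic {f : ℂ → F} {h : ℂ → ℂ} {z : ℂ}
    (hf : ContDiffAt ℝ 2 f (h z)) (hh : AnalyticAt ℂ h z) (v : ℂ) :
    fderiv ℝ (fderiv ℝ (f ∘ h)) z v v =
      fderiv ℝ (fderiv ℝ f) (h z) (deriv h z * v) (deriv h z * v)
        + fderiv ℝ f (h z) (deriv (deriv h) z * v * v) := by
  have hfirst : (fun w => fderiv ℝ (f ∘ h) w v) =ᶠ[𝓝 z]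
      fun w => (fderiv ℝ f ∘ h) w (deriv h w * v) := by
    filter_upwards [hh.continuousAt.eventually (hf.eventually (by simp)),
      hh.eventually_analyticAt] with w hfw hhw
    rw [fderiv_comp w (hfw.differentiableAt (by simp))
      (hhw.differentiableAt.restrictScalars ℝ)]
    simp [fderiv_real_eq_deriv_mul hhw.differentiableAt]
  have hf' : DifferentiableAt ℝ (fderiv ℝ f) (h z) :=
    (hf.fderiv_right (m := 1) (by norm_num)).differentiableAt (by simp)
  have hcomp' : DifferentiableAt ℝ (fderiv ℝ (f ∘ h)) z :=
    ((hf.comp z ((hh.contDiffAt (n := 2)).restrict_scalars ℝ)).fderiv_right (m := 1)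
      (by norm_num)).differentiableAt (by simp)
  have hhd : DifferentiableAt ℝ h z := hh.differentiableAt.restrictScalars ℝ
  have hderiv : DifferentiableAt ℂ (fun w => deriv h w * v) z :=
    hh.deriv.differentiableAt.mul_const v
  have hderiv_apply : fderiv ℝ (fun w => deriv h w * v) z v = deriv (deriv h) z * v * v := by
    rw [fderiv_real_eq_deriv_mul hderiv, deriv_mul_const hh.deriv.differentiableAt]
  have hflip : fderiv ℝ (fderiv ℝ (f ∘ h)) z v v =
      fderiv ℝ (fun w => fderiv ℝ (f ∘ h) w v) z v := by
    rw [fderiv_fderiv_apply_const hcomp']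
    rfl
  rw [hflip, hfirst.fderiv_eq,
    fderiv_clm_apply (hf'.comp z hhd) (hderiv.restrictScalars ℝ), fderiv_comp z hf' hhd]
  simp [hderiv_apply, fderiv_real_eq_deriv_mul hh.differentiableAt, add_comm]

theorem bilinear_apply_self_add_apply_mul_I_self (B : ℂ →L[ℝ] ℂ →L[ℝ] F) (w : ℂ) :
    B w w + B (w * Complex.I) (w * Complex.I) =
      ‖w‖ ^ 2 • (B 1 1 + B Complex.I Complex.I) := by
  have hw : w = w.re • (1 : ℂ) + w.im • Complex.I := by simp [Complex.re_add_im]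
  have hwI : w * Complex.I = -(w.im • (1 : ℂ)) + w.re • Complex.I := by
    apply Complex.ext <;> simp
  rw [hwI, ← Complex.normSq_eq_norm_sq, Complex.normSq_apply]
  conv_lhs => enter [1]; rw [hw]
  simp only [map_add, map_neg, map_smul, add_apply, neg_apply, smul_apply]
  module

theorem laplacian_comp_holomorphic {f : ℂ → F} {h : ℂ → ℂ} {z : ℂ}
    (hf : ContDiffAt ℝ 2 f (h z)) (hh : AnalyticAt ℂ h z) :
    Δ (f ∘ h) z = ‖deriv h z‖ ^ 2 • Δ f (h z) := by
  have hI : deriv (deriv h) z * Complex.I * Complex.I = -(deriv (deriv h) z * 1 * 1) := by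
    rw [mul_assoc, Complex.I_mul_I]
    ring
  simp only [InnerProductSpace.laplacian_eq_iteratedFDeriv_complexPlane,
    iteratedFDeriv_two_apply, Matrix.cons_val_zero, Matrix.cons_val_one]
  rw [fderiv_fderiv_comp_holomorphic hf hh, fderiv_fderiv_comp_holomorphic hf hh, hI, map_neg,
    ← bilinear_apply_self_add_apply_mul_I_self, mul_one]
  abel

theorem integral_target_smul_laplacian (e : OpenPartialHomeomorph ℂ ℂ)
    (he : ∀ z ∈ e.source, AnalyticAt ℂ e z) (g : ℂ → ℝ) {f : ℂ → F}
    (hf : ∀ w ∈ e.target, ContDiffAt ℝ 2 f w) :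
    ∫ w in e.target, g w • Δ f w = ∫ z in e.source, g (e z) • Δ (f ∘ e) z := by
  rw [integral_target_eq_integral_abs_det_fderiv_smul volume (f := e)
    (fun z hz => ((he z hz).differentiableAt.restrictScalars ℝ).hasFDerivAt)]
  refine setIntegral_congr_fun e.open_source.measurableSet fun z hz => ?_
  simp only [det_fderiv_real_eq_sq_norm_deriv (he z hz).differentiableAt, abs_sq,
    laplacian_comp_holomorphic (hf _ (e.map_source hz)) (he z hz)]
  exact smul_comm _ _ _

end ComplexPlane

/-! ### Analytic families of linear maps in one variable -/

section SmithForm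

universe u w

theorem analyticAt_clm_apply {𝕜 E V W : Type*} [NontriviallyNormedField 𝕜]
    [NormedAddCommGroup E] [NormedSpace 𝕜 E] [NormedAddCommGroup V] [NormedSpace 𝕜 V]
    [NormedAddCommGroup W] [NormedSpace 𝕜 W] {A : E → V →L[𝕜] W} {b : E → V} {z : E}
    (hA : AnalyticAt 𝕜 A z) (hb : AnalyticAt 𝕜 b z) : AnalyticAt 𝕜 (fun x => A x (b x)) z :=
  ((ContinuousLinearMap.id 𝕜 (V →L[𝕜] W)).analyticAt_bilinear _).comp (hA.prod hb)

theorem analyticAt_clm_comp {𝕜 E V W Z : Type*} [NontriviallyNormedField 𝕜]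
    [NormedAddCommGroup E] [NormedSpace 𝕜 E] [NormedAddCommGroup V] [NormedSpace 𝕜 V]
    [NormedAddCommGroup W] [NormedSpace 𝕜 W] [NormedAddCommGroup Z] [NormedSpace 𝕜 Z]
    {A : E → W →L[𝕜] Z} {B : E → V →L[𝕜] W} {z : E} (hA : AnalyticAt 𝕜 A z)
    (hB : AnalyticAt 𝕜 B z) : AnalyticAt 𝕜 (fun x => (A x).comp (B x)) z :=
  ((ContinuousLinearMap.compL 𝕜 V W Z).analyticAt_bilinear _).comp (hA.prod hB)

theorem linearIndependent_sumElim_cons {K V ι : Type*} [DivisionRing K] [AddCommGroup V]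
    [Module K V] {k : ℕ} {x : V} {f : Fin k → V} {g : ι → V} (μ : V →ₗ[K] K) (hx : μ x ≠ 0)
    (hf : ∀ i, μ (f i) = 0) (hg : ∀ i, μ (g i) = 0)
    (h : LinearIndependent K (Sum.elim f g)) :
    LinearIndependent K (Sum.elim (Fin.cons x f : Fin (k + 1) → V) g) := by
  obtain ⟨f_indep, g_indep, disj⟩ := linearIndependent_sum.1 h
  simp only [Sum.elim_comp_inl, Sum.elim_comp_inr] at f_indep g_indep disj
  have hf' : Submodule.span K (Set.range f) ≤ LinearMap.ker μ :=
    Submodule.span_le.2 (Set.range_subset_iff.2 hf)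
  have hg' : Submodule.span K (Set.range g) ≤ LinearMap.ker μ :=
    Submodule.span_le.2 (Set.range_subset_iff.2 hg)
  refine linearIndependent_sum.2 ⟨linearIndependent_finCons.2
    ⟨f_indep, fun hmem => hx (hf' hmem)⟩, g_indep, ?_⟩
  rw [Sum.elim_comp_inl, Sum.elim_comp_inr, Fin.range_cons, Submodule.disjoint_def]
  intro y hyf hyg
  obtain ⟨a, y', hy', rfl⟩ := Submodule.mem_span_insert.1 hyf
  have ha : a * μ x = 0 := by simpa [LinearMap.mem_ker.1 (hf' hy')] using hg' hyg
  rw [(mul_eq_zero.1 ha).resolve_right hx, zero_smul, zero_add] at hyg ⊢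
  exact Submodule.disjoint_def.1 disj y' hy' hyg

/-- A local Smith normal form of the family `M` at `z₀`, in moving frames rather than matrices: near
`z₀` the vectors `v i` and `u i` frame the source, `M` maps `v i` to `(z - z₀) ^ a i • w i` and
kills `u i`. Thus `u` frames the kernel of `M` off `z₀`, and `w` its image. -/
structure SmithForm {𝕜 V W : Type*} [NontriviallyNormedField 𝕜] [NormedAddCommGroup V]
    [NormedSpace 𝕜 V] [NormedAddCommGroup W] [NormedSpace 𝕜 W] (M : 𝕜 → V →L[𝕜] W) (z₀ : 𝕜)
    (k l : ℕ) where
  v : Fin k → 𝕜 → V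
  u : Fin l → 𝕜 → V
  w : Fin k → 𝕜 → W
  a : Fin k → ℕ
  analyticAt_v : ∀ i, AnalyticAt 𝕜 (v i) z₀
  analyticAt_u : ∀ i, AnalyticAt 𝕜 (u i) z₀
  analyticAt_w : ∀ i, AnalyticAt 𝕜 (w i) z₀
  linearIndependent_source : LinearIndependent 𝕜 (Sum.elim (fun i => v i z₀) (fun i => u i z₀))
  linearIndependent_w : LinearIndependent 𝕜 (fun i => w i z₀)
  map_v : ∀ᶠ z in 𝓝 z₀, ∀ i, M z (v i z) = (z - z₀) ^ a i • w i z
  map_u : ∀ᶠ z in 𝓝 z₀, ∀ i, M z (u i z) = 0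

namespace SmithForm

section

variable {𝕜 V W : Type*} [NontriviallyNormedField 𝕜] [NormedAddCommGroup V] [NormedSpace 𝕜 V]
  [NormedAddCommGroup W] [NormedSpace 𝕜 W] {M : 𝕜 → V →L[𝕜] W} {z₀ : 𝕜} {k l : ℕ}

/-- The Smith form of a family vanishing near `z₀`. -/
def ofEventuallyEqZero (b : Module.Basis (Fin l) 𝕜 V) (hM : ∀ᶠ z in 𝓝 z₀, M z = 0) :
    SmithForm M z₀ 0 l where
  v := Fin.elim0
  u i _ := b i
  w := Fin.elim0
  a := Fin.elim0
  analyticAt_v i := i.elim0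
  analyticAt_u _ := analyticAt_const
  analyticAt_w i := i.elim0
  linearIndependent_source := by
    rw [← linearIndependent_equiv (Equiv.emptySum (Fin 0) (Fin l)).symm]
    exact b.linearIndependent
  linearIndependent_w := linearIndependent_empty_type
  map_v := .of_forall fun _ i => i.elim0
  map_u := by
    filter_upwards [hM] with z hz i
    rw [hz, zero_apply]

variable {μ : V →L[𝕜] 𝕜} {lam : W →L[𝕜] 𝕜} {C : 𝕜 → LinearMap.ker (μ : V →ₗ[𝕜] 𝕜) →L[𝕜] V}
  {N : 𝕜 → LinearMap.ker (μ : V →ₗ[𝕜] 𝕜) →L[𝕜] LinearMap.ker (lam : W →ₗ[𝕜] 𝕜)}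

/-- Adjoin one elementary divisor `(z - z₀) ^ m` to the Smith form of the family `N` that `M`
induces between the kernels of two functionals, the source kernel being moved by `C`. -/
def cons (S : SmithForm N z₀ k l) {m : ℕ} {v₀ : V} {w₀ : 𝕜 → W} (hw₀ : AnalyticAt 𝕜 w₀ z₀)
    (hμ : μ v₀ ≠ 0) (hlam : lam (w₀ z₀) ≠ 0)
    (hM : ∀ᶠ z in 𝓝 z₀, M z v₀ = (z - z₀) ^ m • w₀ z)
    (hC : AnalyticAt 𝕜 C z₀) (hC₀ : ∀ x, C z₀ x = x)
    (hN : ∀ᶠ z in 𝓝 z₀, ∀ x, M z (C z x) = N z x) : SmithForm M z₀ (k + 1) l where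
  v := Fin.cons (fun _ => v₀) fun i z => C z (S.v i z)
  u i z := C z (S.u i z)
  w := Fin.cons w₀ fun i z => S.w i z
  a := Fin.cons m S.a
  analyticAt_v := Fin.cases analyticAt_const fun i => analyticAt_clm_apply hC (S.analyticAt_v i)
  analyticAt_u i := analyticAt_clm_apply hC (S.analyticAt_u i)
  analyticAt_w := Fin.cases hw₀ fun i =>
    ((LinearMap.ker (lam : W →ₗ[𝕜] 𝕜)).subtypeL.analyticAt _).comp (S.analyticAt_w i)
  linearIndependent_source := by
    have hv : (fun i : Fin (k + 1) =>
        (Fin.cons (fun _ => v₀) fun i z => C z (S.v i z) : Fin (k + 1) → 𝕜 → V) i z₀) =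
          Fin.cons v₀ fun i => (S.v i z₀ : V) :=
      funext <| Fin.cases rfl fun i => hC₀ _
    simp only [hv, hC₀]
    refine linearIndependent_sumElim_cons (μ : V →ₗ[𝕜] 𝕜) hμ (fun i => (S.v i z₀).2)
      (fun i => (S.u i z₀).2) ?_
    have := S.linearIndependent_source.map' (Submodule.subtype _) (Submodule.ker_subtype _)
    rwa [Sum.comp_elim] at this
  linearIndependent_w := by
    have hw : (fun i : Fin (k + 1) =>
        (Fin.cons w₀ fun i z => (S.w i z : W) : Fin (k + 1) → 𝕜 → W) i z₀) =
          Fin.cons (w₀ z₀) fun i => (S.w i z₀ : W) :=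
      funext <| Fin.cases rfl fun i => rfl
    rw [hw, linearIndependent_finCons]
    refine ⟨S.linearIndependent_w.map' (Submodule.subtype _) (Submodule.ker_subtype _),
      fun hmem => hlam ?_⟩
    have hle : Submodule.span 𝕜 (Set.range fun i => (S.w i z₀ : W)) ≤
        LinearMap.ker (lam : W →ₗ[𝕜] 𝕜) :=
      Submodule.span_le.2 (Set.range_subset_iff.2 fun i => (S.w i z₀).2)
    exact hle hmem
  map_v := by
    filter_upwards [hM, hN, S.map_v] with z hMz hNz hSz
    exact Fin.cases hMz fun i => by simp [hNz, hSz]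
  map_u := by
    filter_upwards [hN, S.map_u] with z hNz hSz i
    simp [hNz, hSz]

end

/-- Moving `x` along `v₀` by `lam (g z x) / lam (g z v₀)` puts it into the kernel of `lam ∘ g z`. -/
theorem exists_analyticAt_comp_eq_zero {𝕜 V W : Type*} [NontriviallyNormedField 𝕜]
    [NormedAddCommGroup V] [NormedSpace 𝕜 V] [NormedAddCommGroup W] [NormedSpace 𝕜 W] {z₀ : 𝕜}
    {g : 𝕜 → V →L[𝕜] W} (hg : AnalyticAt 𝕜 g z₀) {lam : W →L[𝕜] 𝕜} {v₀ : V}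
    (h : lam (g z₀ v₀) ≠ 0) :
    ∃ C : 𝕜 → LinearMap.ker (lam.comp (g z₀) : V →ₗ[𝕜] 𝕜) →L[𝕜] V,
      AnalyticAt 𝕜 C z₀ ∧ (∀ x, C z₀ x = x) ∧ ∀ᶠ z in 𝓝 z₀, ∀ x, lam (g z (C z x)) = 0 := by
  let α : 𝕜 → 𝕜 := fun z => lam (g z v₀)
  let B : 𝕜 → V →L[𝕜] V := fun z =>
    (α z)⁻¹ • (ContinuousLinearMap.toSpanSingleton 𝕜 v₀).comp (lam.comp (g z))
  have hα : AnalyticAt 𝕜 α z₀ :=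
    (lam.analyticAt _).comp (analyticAt_clm_apply hg analyticAt_const)
  have hB : AnalyticAt 𝕜 B z₀ := (hα.inv h).smul
    (analyticAt_clm_comp analyticAt_const (analyticAt_clm_comp analyticAt_const hg))
  have B_apply (z : 𝕜) (x : V) : B z x = ((α z)⁻¹ * lam (g z x)) • v₀ := by
    simp [B, smul_smul]
  refine ⟨fun z => (ContinuousLinearMap.id 𝕜 V - B z).comp (Submodule.subtypeL _),
    analyticAt_clm_comp (analyticAt_const.sub hB) analyticAt_const, fun x => ?_, ?_⟩
  · have hx : lam (g z₀ x) = 0 := x.2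
    change (x : V) - B z₀ x = x
    rw [B_apply, hx, mul_zero, zero_smul, sub_zero]
  · filter_upwards [hα.continuousAt.eventually_ne h] with z hz x
    change lam (g z (x - B z x)) = 0
    have hz' : lam (g z v₀) ≠ 0 := hz
    simp only [B_apply, map_sub, map_smul, smul_eq_mul, α]
    field_simp
    ring

theorem exists_of_finrank_eq {𝕜 : Type*} [RCLike 𝕜] (z₀ : 𝕜) (n : ℕ) :
    ∀ (V : Type u) (W : Type w) [NormedAddCommGroup V] [NormedSpace 𝕜 V] [FiniteDimensional 𝕜 V]
      [NormedAddCommGroup W] [NormedSpace 𝕜 W] (M : 𝕜 → V →L[𝕜] W),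
      Module.finrank 𝕜 V = n → AnalyticAt 𝕜 M z₀ →
        ∃ k l : ℕ, k + l = n ∧ Nonempty (SmithForm M z₀ k l) := by
  induction n with
  | zero =>
    intro V W _ _ _ _ _ M hV _
    have : Subsingleton V := Module.finrank_zero_iff.1 hV
    exact ⟨0, 0, rfl, ⟨ofEventuallyEqZero (Module.finBasisOfFinrankEq 𝕜 V hV)
      (.of_forall fun z => Subsingleton.elim _ _)⟩⟩
  | succ n ih =>
    intro V W _ _ _ _ _ M hV hM
    by_cases hord : analyticOrderAt M z₀ = ⊤
    · exact ⟨0, n + 1, zero_add _, ⟨ofEventuallyEqZero (Module.finBasisOfFinrankEq 𝕜 V hV)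
        (analyticOrderAt_eq_top.1 hord)⟩⟩
    obtain ⟨g, hg, hg₀, hMg⟩ := hM.analyticOrderAt_ne_top.1 hord
    obtain ⟨v₀, hv₀⟩ : ∃ v₀, g z₀ v₀ ≠ 0 := by
      contrapose! hg₀
      exact ContinuousLinearMap.ext hg₀
    obtain ⟨lam, hlam⟩ := SeparatingDual.exists_eq_one (R := 𝕜) hv₀
    have hlam₀ : lam (g z₀ v₀) ≠ 0 := by simp [hlam]
    obtain ⟨C, hC, hC₀, hlamC⟩ := exists_analyticAt_comp_eq_zero hg hlam₀
    obtain ⟨pr, hpr⟩ := lam.ker_closedComplemented_of_finiteDimensional_range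
    have hker : Module.finrank 𝕜 (LinearMap.ker (lam.comp (g z₀) : V →ₗ[𝕜] 𝕜)) = n := by
      have hne : (lam.comp (g z₀) : V →ₗ[𝕜] 𝕜) ≠ 0 := fun h => hlam₀ (LinearMap.congr_fun h v₀)
      have := Module.Dual.finrank_ker_add_one_of_ne_zero (f := (lam.comp (g z₀) : V →ₗ[𝕜] 𝕜)) hne
      lia
    let N := fun z => (z - z₀) ^ analyticOrderNatAt M z₀ • pr.comp ((g z).comp (C z))
    have hN : AnalyticAt 𝕜 N z₀ := ((analyticAt_id.sub analyticAt_const).pow _).smul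
      (analyticAt_clm_comp analyticAt_const (analyticAt_clm_comp hg hC))
    obtain ⟨k, l, hkl, ⟨S⟩⟩ := ih _ _ N hker hN
    refine ⟨k + 1, l, by lia, ⟨S.cons (analyticAt_clm_apply hg analyticAt_const) hlam₀ hlam₀
      (hMg.mono fun z hz => by rw [hz]; rfl) hC hC₀ ?_⟩⟩
    filter_upwards [hMg, hlamC] with z hz hCz x
    change M z (C z x) = (z - z₀) ^ analyticOrderNatAt M z₀ • (pr (g z (C z x)) : W)
    rw [hz, hpr ⟨_, hCz x⟩, smul_apply]

end SmithForm

end SmithForm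

/-! ### Gram determinants -/

section Gram

variable {𝕜 V ι κ : Type*} [RCLike 𝕜] [AddCommGroup V] [Module 𝕜 V]
  (c : InnerProductSpace.Core 𝕜 V) [Fintype ι] [DecidableEq ι] [Fintype κ] [DecidableEq κ]

/-- The Gram determinant of a family of vectors, for an inner product that is not an instance: the
inner products here are the values of a hermitian metric at varying points. -/
def gramDet (b : ι → V) : ℝ :=
  RCLike.re (Matrix.det (Matrix.of fun i j => c.inner (b i) (b j)))

theorem gramDet_pos {b : ι → V} (hb : LinearIndependent 𝕜 b) : 0 < gramDet c b := by
  let : NormedAddCommGroup V := c.toNormedAddCommGroup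
  let : InnerProductSpace 𝕜 V := InnerProductSpace.ofCore c.toCore
  exact (RCLike.pos_iff.1 (Matrix.posDef_gram_of_linearIndependent hb).det_pos).1

theorem gramDet_of_eq_sum {b b' : ι → V} (P : Matrix ι ι 𝕜) (h : ∀ i, b' i = ∑ j, P i j • b j) :
    gramDet c b' = ‖P.det‖ ^ 2 * gramDet c b := by
  let : NormedAddCommGroup V := c.toNormedAddCommGroup
  let : InnerProductSpace 𝕜 V := InnerProductSpace.ofCore c.toCore
  have hgram : Matrix.gram 𝕜 b' = P.map (starRingEnd 𝕜) * Matrix.gram 𝕜 b * P.transpose := by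
    ext i j
    simp only [Matrix.mul_apply, Matrix.gram_apply, Matrix.map_apply, Matrix.transpose_apply, h,
      sum_inner, inner_sum, inner_smul_left, inner_smul_right, Finset.sum_mul, Finset.mul_sum]
    exact Finset.sum_congr rfl fun _ _ => Finset.sum_congr rfl fun _ _ => by ring
  have hdet : (P.map (starRingEnd 𝕜)).det = (starRingEnd 𝕜) P.det :=
    ((starRingEnd 𝕜).map_det P).symm
  change RCLike.re (Matrix.gram 𝕜 b').det = ‖P.det‖ ^ 2 * RCLike.re (Matrix.gram 𝕜 b).det
  rw [hgram, Matrix.det_mul, Matrix.det_mul, Matrix.det_transpose, hdet, mul_right_comm,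
    RCLike.conj_mul, ← RCLike.ofReal_pow, RCLike.re_ofReal_mul]

theorem gramDet_smul (b : ι → V) (a : ι → 𝕜) :
    gramDet c (fun i => a i • b i) = ‖∏ i, a i‖ ^ 2 * gramDet c b := by
  rw [gramDet_of_eq_sum c (Matrix.diagonal a) (b := b), Matrix.det_diagonal]
  simp [Matrix.diagonal_apply]

theorem gramDet_comp_equiv (b : ι → V) (e : κ ≃ ι) : gramDet c (b ∘ e) = gramDet c b :=
  congrArg RCLike.re
    (Matrix.det_submatrix_equiv_self e (Matrix.of fun i j => c.inner (b i) (b j)))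

/-- Two block triangular changes of frame enter the numerator and the denominator with the same
determinants: `(v, s)` changes by a block triangular matrix, `s` and `T v` by its two diagonal
blocks. -/
theorem gramDet_map_mul_gramDet_div_eq {W : Type*} [AddCommGroup W] [Module 𝕜 W]
    (cW : InnerProductSpace.Core 𝕜 W) {T : V →ₗ[𝕜] W} {v v' : ι → V} {s s' : κ → V}
    (hs : ∀ j, T (s j) = 0)
    (hv' : LinearIndependent 𝕜 (Sum.elim v' s'))
    (hspan : ∀ i, v' i ∈ Submodule.span 𝕜 (Set.range (Sum.elim v s)))
    (hss : ∀ j, s' j ∈ Submodule.span 𝕜 (Set.range s)) :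
    gramDet cW (fun i => T (v' i)) * gramDet c s' / gramDet c (Sum.elim v' s') =
      gramDet cW (fun i => T (v i)) * gramDet c s / gramDet c (Sum.elim v s) := by
  choose p hp using fun i => (Submodule.mem_span_range_iff_exists_fun 𝕜).1 (hspan i)
  choose d hd using fun j => (Submodule.mem_span_range_iff_exists_fun 𝕜).1 (hss j)
  let A : Matrix ι ι 𝕜 := .of fun i j => p i (Sum.inl j)
  let B : Matrix ι κ 𝕜 := .of fun i j => p i (Sum.inr j)
  let D : Matrix κ κ 𝕜 := .of d
  have gram_s : gramDet c s' = ‖D.det‖ ^ 2 * gramDet c s :=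
    gramDet_of_eq_sum c D fun i => (hd i).symm
  have gram_Tv : gramDet cW (fun i => T (v' i)) = ‖A.det‖ ^ 2 * gramDet cW (fun i => T (v i)) :=
    gramDet_of_eq_sum cW A fun i => by simp [← hp i, A, hs]
  have gram_vs : gramDet c (Sum.elim v' s') =
      ‖A.det‖ ^ 2 * ‖D.det‖ ^ 2 * gramDet c (Sum.elim v s) := by
    rw [← mul_pow, ← norm_mul, ← Matrix.det_fromBlocks_zero₂₁ A B D]
    refine gramDet_of_eq_sum c _ ?_
    rintro (i | i)
    · simp [← hp i, A, B]
    · simp [← hd i, D]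
  have hne := (gramDet_pos c hv').ne'
  rw [gram_vs] at hne
  rw [gram_s, gram_Tv, gram_vs, mul_mul_mul_comm, mul_div_mul_left _ _ (left_ne_zero_of_mul hne)]

end Gram

/-! ### Integration on a compact Riemann surface -/

section Surface

theorem integrableOn_of_eq_zero_sdiff_isCompact {E F : Type*} [TopologicalSpace E]
    [MeasurableSpace E] [OpensMeasurableSpace E] [T2Space E]
    {μ : Measure E} [IsFiniteMeasureOnCompacts μ] [NormedAddCommGroup F] {G : E → F}
    {T K : Set E} (hT : IsOpen T) (hG : ContinuousOn G T) (hK : IsCompact K) (hKT : K ⊆ T)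
    (hG₀ : ∀ z ∈ T \ K, G z = 0) : IntegrableOn G T μ :=
  ((hG.mono hKT).integrableOn_compact hK).of_forall_sdiff_eq_zero hT.measurableSet hG₀

variable {X : Type*} [TopologicalSpace X] [ChartedSpace ℂ X] {c d : X} {z : ℂ}

/-- The inverse of the preferred chart at `c`, as a function on `ℂ`. -/
abbrev chartInv (c : X) : ℂ → X := (chartAt ℂ c).symm

theorem chart_image_subset_target {K : Set X} (hK : K ⊆ (chartAt ℂ c).source) :
    chartAt ℂ c '' K ⊆ (chartAt ℂ c).target :=
  ((chartAt ℂ c).mapsTo.mono_left hK).image_subset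

theorem chartInv_notMem_of_notMem_image {K : Set X} (hz : z ∈ (chartAt ℂ c).target)
    (hK : z ∉ chartAt ℂ c '' K) : chartInv c z ∉ K := fun hmem =>
  hK ⟨_, hmem, (chartAt ℂ c).right_inv hz⟩

theorem isCompact_chart_image_tsupport [CompactSpace X] {M : Type*} [Zero M] {f : X → M}
    (hf : tsupport f ⊆ (chartAt ℂ c).source) : IsCompact (chartAt ℂ c '' tsupport f) :=
  (isClosed_tsupport f).isCompact.image_of_continuousOn ((chartAt ℂ c).continuousOn.mono hf)

theorem laplacian_comp_chartInv_eq_zero {F : Type*} [NormedAddCommGroup F] [NormedSpace ℝ F]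
    {f : X → F} (hz : z ∈ (chartAt ℂ c).target) (hf : chartInv c z ∉ tsupport f) :
    Δ (f ∘ chartInv c) z = 0 :=
  laplacian_eq_zero_of_eventuallyEq_zero <|
    ((chartAt ℂ c).continuousAt_symm hz).eventually (notMem_tsupport_iff_eventuallyEq.1 hf)

variable [IsManifold 𝓘(ℂ, ℂ) ω X]

theorem contDiffAt_comp_chartInv {F : Type*} [NormedAddCommGroup F] [NormedSpace ℝ F] {f : X → F}
    (hz : z ∈ (chartAt ℂ c).target) {n : ℕ∞}
    (hf : ContMDiffAt 𝓘(ℝ, ℂ) 𝓘(ℝ, F) n f (chartInv c z)) :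
    ContDiffAt ℝ n (f ∘ chartInv c) z := by
  have := isManifold_real X
  have h : ContMDiffAt 𝓘(ℝ, ℂ) 𝓘(ℝ, ℂ) ∞ (chartInv c) z :=
    (contMDiffOn_chart_symm (x := c)).contMDiffAt ((chartAt ℂ c).open_target.mem_nhds hz)
  exact (hf.comp z (h.of_le (WithTop.coe_le_coe.2 le_top))).contDiffAt

theorem analyticAt_transition (hz : z ∈ ((chartAt ℂ c).symm ≫ₕ chartAt ℂ d).source) :
    AnalyticAt ℂ ((chartAt ℂ c).symm ≫ₕ chartAt ℂ d) z := by
  have h := (contDiffGroupoid ω 𝓘(ℂ, ℂ)).compatible (M := X) (chart_mem_atlas ℂ c)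
    (chart_mem_atlas ℂ d)
  rw [contDiffGroupoid, mem_groupoid_of_pregroupoid] at h
  have h' : ContDiffOn ℂ ω ((chartAt ℂ c).symm ≫ₕ chartAt ℂ d)
    ((chartAt ℂ c).symm ≫ₕ chartAt ℂ d).source := by simpa [contDiffPregroupoid] using h.1
  exact (h'.contDiffAt (((chartAt ℂ c).symm ≫ₕ chartAt ℂ d).open_source.mem_nhds hz)).analyticAt

theorem continuousOn_laplacian_comp_chartInv {f : X → ℝ} (hf : ContMDiff 𝓘(ℝ, ℂ) 𝓘(ℝ, ℝ) 2 f)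
    (c : X) : ContinuousOn (Δ (f ∘ chartInv c)) (chartAt ℂ c).target := fun _ hz =>
  (continuousAt_laplacian (contDiffAt_comp_chartInv hz (hf _))).continuousWithinAt

theorem setIntegral_transition_source_mul_laplacian {ψ f : X → ℝ}
    (hf : ContMDiff 𝓘(ℝ, ℂ) 𝓘(ℝ, ℝ) 2 f) (c d : X) :
    ∫ z in ((chartAt ℂ c).symm ≫ₕ chartAt ℂ d).source,
        ψ (chartInv c z) * Δ (f ∘ chartInv c) z =
      ∫ z in ((chartAt ℂ c).symm ≫ₕ chartAt ℂ d).target,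
        ψ (chartInv d z) * Δ (f ∘ chartInv d) z := by
  set e : OpenPartialHomeomorph ℂ ℂ := (chartAt ℂ c).symm ≫ₕ chartAt ℂ d with he
  have chartInv_comp (w : ℂ) (hw : w ∈ e.source) : chartInv d (e w) = chartInv c w :=
    (chartAt ℂ d).left_inv (by simpa [he] using hw.2)
  simp only [← smul_eq_mul]
  rw [integral_target_smul_laplacian e (fun z hz => analyticAt_transition hz) _ fun w hw =>
    contDiffAt_comp_chartInv (by simpa [he] using hw.1) (hf _)]
  refine setIntegral_congr_fun e.open_source.measurableSet fun z hz => ?_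
  have hev : (f ∘ chartInv d) ∘ e =ᶠ[𝓝 z] f ∘ chartInv c := by
    filter_upwards [e.open_source.mem_nhds hz] with w hw
    exact congrArg f (chartInv_comp w hw)
  simp only [chartInv_comp z hz, (InnerProductSpace.laplacian_congr_nhds hev).eq_of_nhds]

theorem setIntegral_mul_laplacian_change_chart {ψ f : X → ℝ}
    (hf : ContMDiff 𝓘(ℝ, ℂ) 𝓘(ℝ, ℝ) 2 f) (hψc : tsupport ψ ⊆ (chartAt ℂ c).source)
    (hfd : tsupport f ⊆ (chartAt ℂ d).source) :
    ∫ z in (chartAt ℂ c).target, ψ (chartInv c z) * Δ (f ∘ chartInv c) z =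
      ∫ z in (chartAt ℂ d).target, ψ (chartInv d z) * Δ (f ∘ chartInv d) z := by
  have hc : ∫ z in ((chartAt ℂ c).symm ≫ₕ chartAt ℂ d).source,
      ψ (chartInv c z) * Δ (f ∘ chartInv c) z =
        ∫ z in (chartAt ℂ c).target, ψ (chartInv c z) * Δ (f ∘ chartInv c) z := by
    refine (setIntegral_eq_of_subset_of_forall_sdiff_eq_zero
      (chartAt ℂ c).open_target.measurableSet (fun z hz => by simpa using hz.1) fun z hz => ?_).symm
    rw [laplacian_comp_chartInv_eq_zero hz.1 fun hmem => hz.2 (by simpa using ⟨hz.1, hfd hmem⟩),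
      mul_zero]
  have hd : ∫ z in ((chartAt ℂ c).symm ≫ₕ chartAt ℂ d).target,
      ψ (chartInv d z) * Δ (f ∘ chartInv d) z =
        ∫ z in (chartAt ℂ d).target, ψ (chartInv d z) * Δ (f ∘ chartInv d) z := by
    refine (setIntegral_eq_of_subset_of_forall_sdiff_eq_zero
      (chartAt ℂ d).open_target.measurableSet (fun z hz => by simpa using hz.1) fun z hz => ?_).symm
    rw [image_eq_zero_of_notMem_tsupport (f := ψ) fun hmem =>
      hz.2 (by simpa using ⟨hz.1, hψc hmem⟩), zero_mul]
  rw [← hc, ← hd, setIntegral_transition_source_mul_laplacian hf]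

variable [CompactSpace X]

theorem setIntegral_laplacian_comp_chartInv {f : X → ℝ} (hf : ContMDiff 𝓘(ℝ, ℂ) 𝓘(ℝ, ℝ) 2 f)
    (hfc : tsupport f ⊆ (chartAt ℂ c).source) :
    ∫ z in (chartAt ℂ c).target, Δ (f ∘ chartInv c) z = 0 :=
  setIntegral_laplacian_eq_zero (chartAt ℂ c).open_target (isCompact_chart_image_tsupport hfc)
    (chart_image_subset_target hfc) (fun _ hz => contDiffAt_comp_chartInv hz (hf _)) fun _ hz =>
      image_eq_zero_of_notMem_tsupport (f := f) (chartInv_notMem_of_notMem_image hz.1 hz.2)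

variable [T2Space X]

theorem contMDiff_partition (c : X) : ContMDiff 𝓘(ℝ, ℂ) 𝓘(ℝ, ℝ) ∞ (partition X c) :=
  (partition X c).contMDiff

theorem tsupport_partition (c : X) : tsupport (partition X c) ⊆ (chartAt ℂ c).source :=
  (exists_partition X).choose_spec c

variable (X) in
/-- The finitely many charts that occur in the partition of unity. -/
def partitionIndex : Finset X :=
  (partition X).locallyFinite.finite_nonempty_of_compact.toFinset

theorem partition_eq_zero (hc : c ∉ partitionIndex X) (q : X) : partition X c q = 0 := by
  by_contra h
  exact hc (Set.Finite.mem_toFinset _ |>.2 ⟨q, h⟩)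

theorem sum_partition (q : X) : ∑ c ∈ partitionIndex X, partition X c q = 1 := by
  rw [← (partition X).sum_eq_one (Set.mem_univ q)]
  refine (finsum_eq_sum_of_support_subset _ fun c hc => ?_).symm
  contrapose! hc
  simpa using partition_eq_zero hc q

theorem surfaceIntegral_eq_sum (f : X → ℂ → ℝ) :
    surfaceIntegral f = ∑ c ∈ partitionIndex X,
      ∫ z in (chartAt ℂ c).target, partition X c (chartInv c z) * f c z := by
  refine finsum_eq_sum_of_support_subset _ fun c hc => ?_
  contrapose! hc
  simp [partition_eq_zero hc]

theorem integrableOn_partition_mul {G : ℂ → ℝ} (hG : ContinuousOn G (chartAt ℂ c).target) :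
    IntegrableOn (fun z => partition X c (chartInv c z) * G z) (chartAt ℂ c).target := by
  refine integrableOn_of_eq_zero_sdiff_isCompact (chartAt ℂ c).open_target
    (((contMDiff_partition c).continuous.comp_continuousOn (chartAt ℂ c).continuousOn_symm).mul hG)
    (isCompact_chart_image_tsupport (tsupport_partition c))
    (chart_image_subset_target (tsupport_partition c)) fun z hz => ?_
  rw [image_eq_zero_of_notMem_tsupport (chartInv_notMem_of_notMem_image hz.1 hz.2), zero_mul]

theorem surfaceIntegral_finset_sum {ι : Type*} (s : Finset ι) {f : ι → X → ℂ → ℝ}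
    (hf : ∀ i ∈ s, ∀ c, ContinuousOn (f i c) (chartAt ℂ c).target) :
    surfaceIntegral (fun c z => ∑ i ∈ s, f i c z) = ∑ i ∈ s, surfaceIntegral (f i) := by
  simp only [surfaceIntegral_eq_sum, Finset.mul_sum]
  rw [Finset.sum_comm]
  exact Finset.sum_congr rfl fun c _ =>
    integral_finsetSum _ fun i hi => integrableOn_partition_mul (hf i hi c)

theorem surfaceIntegral_add {f g : X → ℂ → ℝ}
    (hf : ∀ c, ContinuousOn (f c) (chartAt ℂ c).target)
    (hg : ∀ c, ContinuousOn (g c) (chartAt ℂ c).target) :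
    surfaceIntegral (fun c z => f c z + g c z) = surfaceIntegral f + surfaceIntegral g := by
  simp only [surfaceIntegral_eq_sum, mul_add, ← Finset.sum_add_distrib]
  exact Finset.sum_congr rfl fun c _ =>
    integral_add (integrableOn_partition_mul (hf c)) (integrableOn_partition_mul (hg c))

theorem surfaceIntegral_sub {f g : X → ℂ → ℝ}
    (hf : ∀ c, ContinuousOn (f c) (chartAt ℂ c).target)
    (hg : ∀ c, ContinuousOn (g c) (chartAt ℂ c).target) :
    surfaceIntegral (fun c z => f c z - g c z) = surfaceIntegral f - surfaceIntegral g := by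
  simp only [surfaceIntegral_eq_sum, mul_sub, ← Finset.sum_sub_distrib]
  exact Finset.sum_congr rfl fun c _ =>
    integral_sub (integrableOn_partition_mul (hf c)) (integrableOn_partition_mul (hg c))

theorem surfaceIntegral_const_mul (a : ℝ) (f : X → ℂ → ℝ) :
    surfaceIntegral (fun c z => a * f c z) = a * surfaceIntegral f := by
  simp only [surfaceIntegral_eq_sum, mul_left_comm _ a, integral_const_mul, Finset.mul_sum]

theorem surfaceIntegral_mono {f g : X → ℂ → ℝ}
    (hf : ∀ c, ContinuousOn (f c) (chartAt ℂ c).target)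
    (hg : ∀ c, ContinuousOn (g c) (chartAt ℂ c).target)
    (hfg : ∀ c, ∀ z ∈ (chartAt ℂ c).target, f c z ≤ g c z) :
    surfaceIntegral f ≤ surfaceIntegral g := by
  simp only [surfaceIntegral_eq_sum]
  exact Finset.sum_le_sum fun c _ => setIntegral_mono_on (integrableOn_partition_mul (hf c))
    (integrableOn_partition_mul (hg c)) (chartAt ℂ c).open_target.measurableSet fun z hz =>
      mul_le_mul_of_nonneg_left (hfg c z hz) ((partition X).nonneg c _)

theorem tendsto_surfaceIntegral {ι : Type*} {l : Filter ι} [l.IsCountablyGenerated]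
    {f : ι → X → ℂ → ℝ} {g : X → ℂ → ℝ}
    (hf : ∀ i c, ContinuousOn (f i c) (chartAt ℂ c).target)
    (hg : ∀ c, ContinuousOn (g c) (chartAt ℂ c).target)
    (hle : ∀ i c, ∀ z ∈ (chartAt ℂ c).target, |f i c z| ≤ |g c z|)
    (hlim : ∀ c, ∀ᵐ z ∂volume.restrict (chartAt ℂ c).target,
      Tendsto (fun i => f i c z) l (𝓝 (g c z))) :
    Tendsto (fun i => surfaceIntegral (f i)) l (𝓝 (surfaceIntegral g)) := by
  simp only [surfaceIntegral_eq_sum]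
  refine tendsto_finsetSum _ fun c _ => tendsto_integral_filter_of_dominated_convergence _
    (.of_forall fun i => (integrableOn_partition_mul (hf i c)).aestronglyMeasurable)
    (.of_forall fun i => ?_) (integrableOn_partition_mul (hg c)).norm ?_
  · filter_upwards [ae_restrict_mem (chartAt ℂ c).open_target.measurableSet] with z hz
    simp only [norm_mul, Real.norm_eq_abs]
    exact mul_le_mul_of_nonneg_left (hle i c z hz) (abs_nonneg _)
  · filter_upwards [hlim c] with z hz using hz.const_mul _

theorem surfaceIntegral_laplacian_of_tsupport_subset {f : X → ℝ}
    (hf : ContMDiff 𝓘(ℝ, ℂ) 𝓘(ℝ, ℝ) 2 f) (hfd : tsupport f ⊆ (chartAt ℂ d).source) :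
    surfaceIntegral (fun c => Δ (f ∘ chartInv c)) = 0 := by
  rw [surfaceIntegral_eq_sum]
  simp only [setIntegral_mul_laplacian_change_chart hf (tsupport_partition _) hfd]
  rw [← integral_finsetSum _ fun c _ => ?_]
  · simpa only [← Finset.sum_mul, sum_partition, one_mul] using
      setIntegral_laplacian_comp_chartInv hf hfd
  · refine integrableOn_of_eq_zero_sdiff_isCompact (chartAt ℂ d).open_target
      (((contMDiff_partition c).continuous.comp_continuousOn (chartAt ℂ d).continuousOn_symm).mul
        (continuousOn_laplacian_comp_chartInv hf d))
      (isCompact_chart_image_tsupport hfd) (chart_image_subset_target hfd) fun z hz => ?_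
    rw [laplacian_comp_chartInv_eq_zero hz.1 (chartInv_notMem_of_notMem_image hz.1 hz.2), mul_zero]

theorem surfaceIntegral_laplacian {F : X → ℝ} (hF : ContMDiff 𝓘(ℝ, ℂ) 𝓘(ℝ, ℝ) 2 F) :
    surfaceIntegral (fun c => Δ (F ∘ chartInv c)) = 0 := by
  let f : X → X → ℝ := fun d q => partition X d q * F q
  have hf (d : X) : ContMDiff 𝓘(ℝ, ℂ) 𝓘(ℝ, ℝ) 2 (f d) :=
    ((contMDiff_partition d).of_le (WithTop.coe_le_coe.2 le_top)).mul hF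
  have tsupport_f (d : X) : tsupport (f d) ⊆ (chartAt ℂ d).source :=
    tsupport_mul_subset_left.trans (tsupport_partition d)
  have F_eq (c : X) : F ∘ chartInv c = ∑ d ∈ partitionIndex X, f d ∘ chartInv c := by
    ext z
    simp [f, ← Finset.sum_mul, sum_partition]
  calc surfaceIntegral (fun c => Δ (F ∘ chartInv c))
      = surfaceIntegral (fun c z => ∑ d ∈ partitionIndex X, Δ (f d ∘ chartInv c) z) := by
        simp only [surfaceIntegral_eq_sum]
        refine Finset.sum_congr rfl fun c _ => setIntegral_congr_fun
          (chartAt ℂ c).open_target.measurableSet fun z hz => ?_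
        simp only [F_eq, laplacian_finset_sum _ fun d _ => contDiffAt_comp_chartInv hz (hf d _)]
    _ = ∑ d ∈ partitionIndex X, surfaceIntegral (fun c => Δ (f d ∘ chartInv c)) :=
        surfaceIntegral_finset_sum _ fun d _ => continuousOn_laplacian_comp_chartInv (hf d)
    _ = 0 := Finset.sum_eq_zero fun d _ =>
        surfaceIntegral_laplacian_of_tsupport_subset (hf d) (tsupport_f d)

end Surface

/-! ### Local coordinates for bundles and sections -/

section Coordinates

universe w

variable {X : Type*} [TopologicalSpace X] {r : ℕ} {E : X → Type w}
  [∀ p, TopologicalSpace (E p)]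
  [TopologicalSpace (TotalSpace (Fin r → ℂ) E)] [FiberBundle (Fin r → ℂ) E]

variable (r) in
/-- Continuity at `p` of a section, as a map into the total space. -/
def ContinuousSectionAt (s : ∀ q, E q) (p : X) : Prop :=
  ContinuousAt (fun q => (⟨q, s q⟩ : TotalSpace (Fin r → ℂ) E)) p

theorem IsHolomorphicSectionOn.continuousSectionAt [ChartedSpace ℂ X] {s : ∀ q, E q} {U : Set X}
    (hs : IsHolomorphicSectionOn r s U) {p : X} (hU : U ∈ 𝓝 p) : ContinuousSectionAt r s p :=
  (ContMDiffOn.contMDiffAt hs hU).continuousAt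

variable [∀ p, AddCommGroup (E p)] [∀ p, Module ℂ (E p)] [VectorBundle ℂ (Fin r → ℂ) E]
  {ι : Type*} {b q : X}

variable (r E) in
/-- The domain of the preferred trivialization at `b`. -/
abbrev coordSet (b : X) : Set X := (trivializationAt (Fin r → ℂ) E b).baseSet

variable (r E) in
/-- The coordinates of a vector of the fibre `E q` in the preferred trivialization at `b`; the junk
value `0` if `q` is not in `coordSet r E b`. -/
def coordMap (b q : X) : E q →ₗ[ℂ] (Fin r → ℂ) :=
  (trivializationAt (Fin r → ℂ) E b).linearMapAt ℂ q

variable (r E) in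
/-- The vector of the fibre `E q` with given coordinates in the preferred trivialization at `b`; the
junk value `0` if `q` is not in `coordSet r E b`. -/
def coordSymm (b q : X) : (Fin r → ℂ) →ₗ[ℂ] E q :=
  (trivializationAt (Fin r → ℂ) E b).symmₗ ℂ q

theorem coordMap_apply (hq : q ∈ coordSet r E b) (x : E q) :
    coordMap r E b q x = (trivializationAt (Fin r → ℂ) E b ⟨q, x⟩).2 := by
  rw [coordMap, Trivialization.coe_linearMapAt_of_mem _ hq]

theorem coordMap_coordSymm (hq : q ∈ coordSet r E b) (y : Fin r → ℂ) :
    coordMap r E b q (coordSymm r E b q y) = y :=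
  Trivialization.linearMapAt_symmₗ _ hq y

theorem coordSymm_coordMap (hq : q ∈ coordSet r E b) (x : E q) :
    coordSymm r E b q (coordMap r E b q x) = x :=
  Trivialization.symmₗ_linearMapAt _ hq x

theorem linearIndependent_coordMap (hq : q ∈ coordSet r E b) {f : ι → E q}
    (hf : LinearIndependent ℂ f) : LinearIndependent ℂ (fun i => coordMap r E b q (f i)) :=
  hf.map' _ (LinearMap.ker_eq_bot_of_inverse (LinearMap.ext (coordSymm_coordMap hq)))

theorem linearIndependent_coordSymm (hq : q ∈ coordSet r E b)
    {f : ι → Fin r → ℂ} (hf : LinearIndependent ℂ f) :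
    LinearIndependent ℂ (fun i => coordSymm r E b q (f i)) :=
  hf.map' _ (LinearMap.ker_eq_bot_of_inverse (LinearMap.ext (coordMap_coordSymm hq)))

variable (r E) in
/-- The fibre at `q` is identified with the model fibre by the preferred trivialization at `q`. -/
def fibreEquiv (q : X) : E q ≃ₗ[ℂ] (Fin r → ℂ) :=
  (trivializationAt (Fin r → ℂ) E q).linearEquivAt ℂ q (mem_baseSet_trivializationAt _ _ _)

variable (r E) in
theorem finrank_fibre (q : X) : Module.finrank ℂ (E q) = r := by
  rw [(fibreEquiv r E q).finrank_eq, Module.finrank_fin_fun]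

theorem continuousSectionAt_iff {s : ∀ q, E q} {p : X} (hp : p ∈ coordSet r E b) :
    ContinuousSectionAt r s p ↔ ContinuousAt (fun q => coordMap r E b q (s q)) p := by
  have hev : (fun q => coordMap r E b q (s q)) =ᶠ[𝓝 p]
      fun q => (trivializationAt (Fin r → ℂ) E b ⟨q, s q⟩).2 := by
    filter_upwards [(trivializationAt (Fin r → ℂ) E b).open_baseSet.mem_nhds hp] with q hq
    exact coordMap_apply hq _
  rw [continuousAt_congr hev, ContinuousSectionAt, ContinuousAt,
    (trivializationAt (Fin r → ℂ) E b).tendsto_nhds_iff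
      ((trivializationAt (Fin r → ℂ) E b).mem_source.2 hp)]
  exact and_iff_right continuousAt_id

variable [ChartedSpace ℂ X] [IsManifold 𝓘(ℂ, ℂ) ω X] {c : X}

theorem analyticAt_comp_chartInv {F : Type*} [NormedAddCommGroup F] [NormedSpace ℂ F]
    {f : X → F} (hq : q ∈ (chartAt ℂ c).source)
    (hf : ContMDiffAt 𝓘(ℂ, ℂ) 𝓘(ℂ, F) ω f q) : AnalyticAt ℂ (f ∘ chartInv c) (chartAt ℂ c q) := by
  have hchart : ContMDiffAt 𝓘(ℂ, ℂ) 𝓘(ℂ, ℂ) ω (chartInv c) (chartAt ℂ c q) :=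
    (contMDiffOn_chart_symm (x := c)).contMDiffAt
      ((chartAt ℂ c).open_target.mem_nhds ((chartAt ℂ c).map_source hq))
  rw [← (chartAt ℂ c).left_inv hq] at hf
  exact (hf.comp _ hchart).contDiffAt.analyticAt

theorem contMDiffAt_comp_chart {F : Type*} [NormedAddCommGroup F] [NormedSpace ℂ F]
    [CompleteSpace F] {f : ℂ → F} (hq : q ∈ (chartAt ℂ c).source)
    (hf : AnalyticAt ℂ f (chartAt ℂ c q)) :
    ContMDiffAt 𝓘(ℂ, ℂ) 𝓘(ℂ, F) ω (f ∘ chartAt ℂ c) q :=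
  (hf.contDiffAt (n := ω)).contMDiffAt.comp q
    ((contMDiffOn_chart (x := c)).contMDiffAt ((chartAt ℂ c).open_source.mem_nhds hq))

variable [ContMDiffVectorBundle ω (Fin r → ℂ) E 𝓘(ℂ, ℂ)]

theorem IsHolomorphicSectionOn.analyticAt {s : ∀ q, E q} {U : Set X}
    (hs : IsHolomorphicSectionOn r s U) (hU : U ∈ 𝓝 q) (hq : q ∈ (chartAt ℂ c).source)
    (hq' : q ∈ coordSet r E b) :
    AnalyticAt ℂ (fun z => coordMap r E b (chartInv c z) (s (chartInv c z))) (chartAt ℂ c q) := by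
  have hcoord := ((trivializationAt (Fin r → ℂ) E b).contMDiffAt_section_iff (n := ω)
    (IB := 𝓘(ℂ, ℂ)) hq').1 (ContMDiffOn.contMDiffAt hs hU)
  refine analyticAt_comp_chartInv (f := fun x => coordMap r E b x (s x)) hq
    (hcoord.congr_of_eventuallyEq ?_)
  filter_upwards [(trivializationAt (Fin r → ℂ) E b).open_baseSet.mem_nhds hq'] with x hx
  exact coordMap_apply hx _

theorem isHolomorphicSectionOn_coordSymm {σ : ℂ → Fin r → ℂ} {U : Set X} (hU : IsOpen U)
    (hUc : U ⊆ (chartAt ℂ c).source) (hUb : U ⊆ coordSet r E b)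
    (hσ : ∀ q ∈ U, AnalyticAt ℂ σ (chartAt ℂ c q)) :
    IsHolomorphicSectionOn r (fun q => coordSymm r E b q (σ (chartAt ℂ c q))) U := by
  intro q hq
  refine ContMDiffAt.contMDiffWithinAt ?_
  rw [(trivializationAt (Fin r → ℂ) E b).contMDiffAt_section_iff (hUb hq)]
  refine (contMDiffAt_comp_chart (hUc hq) (hσ q hq)).congr_of_eventuallyEq ?_
  filter_upwards [hU.mem_nhds hq] with x hx
  rw [← coordMap_apply (hUb hx), coordMap_coordSymm (hUb hx), Function.comp_apply]

end Coordinates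

/-! ### Holomorphic bundle morphisms in adapted frames -/

section AdaptedFrame

universe w

variable {X : Type*} [TopologicalSpace X] {r r' : ℕ} {E E' : X → Type w}
  [∀ p, AddCommGroup (E p)] [∀ p, Module ℂ (E p)] [∀ p, TopologicalSpace (E p)]
  [TopologicalSpace (TotalSpace (Fin r → ℂ) E)] [FiberBundle (Fin r → ℂ) E]
  [∀ p, AddCommGroup (E' p)] [∀ p, Module ℂ (E' p)] [∀ p, TopologicalSpace (E' p)]
  [TopologicalSpace (TotalSpace (Fin r' → ℂ) E')] [FiberBundle (Fin r' → ℂ) E']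

section

variable [VectorBundle ℂ (Fin r → ℂ) E] [VectorBundle ℂ (Fin r' → ℂ) E']

variable (r r') in
/-- The matrix, as a linear map between the model fibres, of the bundle morphism `T` at `q` in the
preferred trivializations at `b`. -/
def coordHom (T : FibreMap E E') (b q : X) : (Fin r → ℂ) →L[ℂ] (Fin r' → ℂ) :=
  LinearMap.toContinuousLinearMap (coordMap r' E' b q ∘ₗ T q ∘ₗ coordSymm r E b q)

theorem coordSymm_coordHom {T : FibreMap E E'} {b q : X} (hq : q ∈ coordSet r' E' b)
    (y : Fin r → ℂ) :
    coordSymm r' E' b q (coordHom r r' T b q y) = T q (coordSymm r E b q y) :=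
  coordSymm_coordMap hq _

end

theorem IsHolomorphicMap.comp_section [ChartedSpace ℂ X] {T : FibreMap E E'}
    (hT : IsHolomorphicMap r r' T) {s : ∀ q, E q} {U : Set X}
    (hs : IsHolomorphicSectionOn r s U) : IsHolomorphicSectionOn r' (fun q => T q (s q)) U :=
  ContMDiff.comp_contMDiffOn hT hs

theorem analyticAt_coordHom [VectorBundle ℂ (Fin r → ℂ) E] [VectorBundle ℂ (Fin r' → ℂ) E']
    [ChartedSpace ℂ X] [IsManifold 𝓘(ℂ, ℂ) ω X] [ContMDiffVectorBundle ω (Fin r → ℂ) E 𝓘(ℂ, ℂ)]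
    [ContMDiffVectorBundle ω (Fin r' → ℂ) E' 𝓘(ℂ, ℂ)] {T : FibreMap E E'}
    (hT : IsHolomorphicMap r r' T) {b c q : X} (hq : q ∈ (chartAt ℂ c).source)
    (hqE : q ∈ coordSet r E b) (hqE' : q ∈ coordSet r' E' b) :
    AnalyticAt ℂ (fun z => coordHom r r' T b (chartInv c z)) (chartAt ℂ c q) := by
  have hO : IsOpen (coordSet r E b ∩ coordSet r' E' b) :=
    (trivializationAt (Fin r → ℂ) E b).open_baseSet.inter
      (trivializationAt (Fin r' → ℂ) E' b).open_baseSet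
  have hU := (chartAt ℂ c).open_source.inter hO
  have hV := (chartAt ℂ c).isOpen_inter_preimage_symm hO
  refine ContDiffAt.analyticAt ?_
  refine (contDiffOn_clm_apply.2 fun y z hz => ?_).contDiffAt
    (hV.mem_nhds ⟨(chartAt ℂ c).map_source hq, by simpa [(chartAt ℂ c).left_inv hq]
      using ⟨hqE, hqE'⟩⟩)
  have hmem : chartInv c z ∈ (chartAt ℂ c).source := (chartAt ℂ c).map_target hz.1
  have hsec := hT.comp_section (isHolomorphicSectionOn_coordSymm (σ := fun _ => y) hU
    Set.inter_subset_left (fun _ h => h.2.1) fun _ _ => analyticAt_const)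
  have hana := hsec.analyticAt (hU.mem_nhds ⟨hmem, hz.2⟩) hmem hz.2.2
  rw [chartInv, (chartAt ℂ c).right_inv hz.1] at hana
  exact hana.contDiffAt.contDiffWithinAt

variable (r r') in
/-- A local normal form of the bundle morphism `T` near `p`, the geometric counterpart of
`SmithForm`: a holomorphic frame `(v, u)` of the source over `U` such that `u` frames the kernel of
`T` away from `p`, and part of a frame `w` of the target that spans the image of `T` away from `p`.
The exponents `a` are the vanishing orders at `p` of `T v i`, in the coordinate centred at `p`. -/
structure AdaptedFrame [ChartedSpace ℂ X] (T : FibreMap E E') (p : X) (k l : ℕ) where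
  U : Set X
  v : Fin k → ∀ q, E q
  u : Fin l → ∀ q, E q
  w : Fin k → ∀ q, E' q
  a : Fin k → ℕ
  isOpen : IsOpen U
  mem : p ∈ U
  subset_source : U ⊆ (chartAt ℂ p).source
  rank_add : k + l = r
  holomorphic_v : ∀ i, IsHolomorphicSectionOn r (v i) U
  holomorphic_u : ∀ i, IsHolomorphicSectionOn r (u i) U
  holomorphic_w : ∀ i, IsHolomorphicSectionOn r' (w i) U
  linearIndependent_source : ∀ q ∈ U,
    LinearIndependent ℂ (Sum.elim (fun i => v i q) (fun i => u i q))
  linearIndependent_w : ∀ q ∈ U, LinearIndependent ℂ (fun i => w i q)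
  map_v : ∀ q ∈ U, ∀ i, T q (v i q) = (chartAt ℂ p q - chartAt ℂ p p) ^ a i • w i q
  map_u : ∀ q ∈ U, ∀ i, T q (u i q) = 0

theorem eventually_linearIndependent {𝕜 ι Y F : Type*} [NontriviallyNormedField 𝕜]
    [CompleteSpace 𝕜] [Finite ι] [TopologicalSpace Y]
    [NormedAddCommGroup F] [NormedSpace 𝕜 F] {f : ι → Y → F} {y : Y}
    (hf : ∀ i, ContinuousAt (f i) y) (h : LinearIndependent 𝕜 (fun i => f i y)) :
    ∀ᶠ x in 𝓝 y, LinearIndependent 𝕜 (fun i => f i x) :=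
  (tendsto_pi_nhds.2 hf).eventually h.eventually

/-- The conditions that a Smith form at `z₀` satisfies at `z₀` or near `z₀`, imposed at the point
`z`. -/
structure SmithForm.ValidAt {𝕜 V W : Type*} [NontriviallyNormedField 𝕜] [NormedAddCommGroup V]
    [NormedSpace 𝕜 V] [NormedAddCommGroup W] [NormedSpace 𝕜 W] {M : 𝕜 → V →L[𝕜] W} {z₀ : 𝕜}
    {k l : ℕ} (S : SmithForm M z₀ k l) (z : 𝕜) : Prop where
  analyticAt_v : ∀ i, AnalyticAt 𝕜 (S.v i) z
  analyticAt_u : ∀ i, AnalyticAt 𝕜 (S.u i) z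
  analyticAt_w : ∀ i, AnalyticAt 𝕜 (S.w i) z
  linearIndependent_source : LinearIndependent 𝕜 fun i => Sum.elim S.v S.u i z
  linearIndependent_w : LinearIndependent 𝕜 fun i => S.w i z
  map_v : ∀ i, M z (S.v i z) = (z - z₀) ^ S.a i • S.w i z
  map_u : ∀ i, M z (S.u i z) = 0

theorem SmithForm.eventually_validAt {𝕜 V W : Type*} [NontriviallyNormedField 𝕜] [CompleteSpace 𝕜]
    [NormedAddCommGroup V] [NormedSpace 𝕜 V] [CompleteSpace V] [NormedAddCommGroup W]
    [NormedSpace 𝕜 W] [CompleteSpace W] {M : 𝕜 → V →L[𝕜] W} {z₀ : 𝕜} {k l : ℕ}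
    (S : SmithForm M z₀ k l) : ∀ᶠ z in 𝓝 z₀, S.ValidAt z := by
  have source_indep : ∀ᶠ z in 𝓝 z₀, LinearIndependent 𝕜 fun i => Sum.elim S.v S.u i z := by
    refine eventually_linearIndependent ?_ ?_
    · rintro (i | i)
      exacts [(S.analyticAt_v i).continuousAt, (S.analyticAt_u i).continuousAt]
    · convert S.linearIndependent_source using 1
      ext (i | i) <;> rfl
  filter_upwards [eventually_all.2 fun i => (S.analyticAt_v i).eventually_analyticAt,
    eventually_all.2 fun i => (S.analyticAt_u i).eventually_analyticAt,
    eventually_all.2 fun i => (S.analyticAt_w i).eventually_analyticAt, source_indep,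
    eventually_linearIndependent (fun i => (S.analyticAt_w i).continuousAt) S.linearIndependent_w,
    S.map_v, S.map_u] with z hv hu hw hvu hw' hmv hmu
  exact ⟨hv, hu, hw, hvu, hw', hmv, hmu⟩

variable [VectorBundle ℂ (Fin r → ℂ) E] [VectorBundle ℂ (Fin r' → ℂ) E']
  [ChartedSpace ℂ X] [IsManifold 𝓘(ℂ, ℂ) ω X] [ContMDiffVectorBundle ω (Fin r → ℂ) E 𝓘(ℂ, ℂ)]
  [ContMDiffVectorBundle ω (Fin r' → ℂ) E' 𝓘(ℂ, ℂ)] {T : FibreMap E E'} {p : X} {k l : ℕ}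

/-- The frame adapted to `T` whose coordinates at `p` are the given Smith form. -/
def AdaptedFrame.ofSmithForm {U : Set X} (hkl : k + l = r)
    (S : SmithForm (fun z => coordHom r r' T p (chartInv p z)) (chartAt ℂ p p) k l)
    (hU : IsOpen U) (hp : p ∈ U) (hUp : U ⊆ (chartAt ℂ p).source) (hUE : U ⊆ coordSet r E p)
    (hUE' : U ⊆ coordSet r' E' p) (hS : ∀ q ∈ U, S.ValidAt (chartAt ℂ p q)) :
    AdaptedFrame r r' T p k l :=
  have map_coordSymm (q : X) (hq : q ∈ U) (y : Fin r → ℂ) : T q (coordSymm r E p q y) =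
      coordSymm r' E' p q (coordHom r r' T p (chartInv p (chartAt ℂ p q)) y) := by
    rw [chartInv, (chartAt ℂ p).left_inv (hUp hq), coordSymm_coordHom (hUE' hq)]
  { U
    v i q := coordSymm r E p q (S.v i (chartAt ℂ p q))
    u i q := coordSymm r E p q (S.u i (chartAt ℂ p q))
    w i q := coordSymm r' E' p q (S.w i (chartAt ℂ p q))
    a := S.a
    isOpen := hU
    mem := hp
    subset_source := hUp
    rank_add := hkl
    holomorphic_v i := isHolomorphicSectionOn_coordSymm hU hUp hUE fun q hq =>
      (hS q hq).analyticAt_v i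
    holomorphic_u i := isHolomorphicSectionOn_coordSymm hU hUp hUE fun q hq =>
      (hS q hq).analyticAt_u i
    holomorphic_w i := isHolomorphicSectionOn_coordSymm hU hUp hUE' fun q hq =>
      (hS q hq).analyticAt_w i
    linearIndependent_source q hq := by
      convert linearIndependent_coordSymm (hUE hq) (hS q hq).linearIndependent_source using 1
      ext (i | i) <;> rfl
    linearIndependent_w q hq :=
      linearIndependent_coordSymm (hUE' hq) (hS q hq).linearIndependent_w
    map_v q hq i := by rw [map_coordSymm q hq, (hS q hq).map_v i, map_smul]
    map_u q hq i := by rw [map_coordSymm q hq, (hS q hq).map_u i, map_zero] }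

theorem exists_adaptedFrame (hT : IsHolomorphicMap r r' T) (p : X) :
    ∃ k l, Nonempty (AdaptedFrame r r' T p k l) := by
  have hp := mem_chart_source ℂ p
  have hpE : p ∈ coordSet r E p := mem_baseSet_trivializationAt (Fin r → ℂ) E p
  have hpE' : p ∈ coordSet r' E' p := mem_baseSet_trivializationAt (Fin r' → ℂ) E' p
  obtain ⟨k, l, hkl, ⟨S⟩⟩ := SmithForm.exists_of_finrank_eq (chartAt ℂ p p) r (Fin r → ℂ)
    (Fin r' → ℂ) _ (Module.finrank_fin_fun ℂ) (analyticAt_coordHom hT hp hpE hpE')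
  obtain ⟨O, hO, O_open, hpO⟩ := eventually_nhds_iff.1 S.eventually_validAt
  have U_open := (((chartAt ℂ p).isOpen_inter_preimage O_open).inter
    (trivializationAt (Fin r → ℂ) E p).open_baseSet).inter
      (trivializationAt (Fin r' → ℂ) E' p).open_baseSet
  exact ⟨k, l, ⟨.ofSmithForm hkl S U_open ⟨⟨⟨hp, hpO⟩, hpE⟩, hpE'⟩ (fun _ hq => hq.1.1.1)
    (fun _ hq => hq.1.2) (fun _ hq => hq.2) fun _ hq => hO _ hq.1.1.2⟩⟩

end AdaptedFrame

/-! ### Saturated kernels and images -/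

theorem perfectSpace_of_chartedSpace (H : Type*) {X : Type*} [TopologicalSpace H]
    [PerfectSpace H] [TopologicalSpace X] [ChartedSpace H X] : PerfectSpace X := by
  refine perfectSpace_iff_forall_not_isolated.2 fun p => ?_
  rw [neBot_iff, ne_eq, ← isOpen_singleton_iff_punctured_nhds]
  intro hp
  have himage := (chartAt H p).isOpen_image_of_subset_source hp
    (Set.singleton_subset_iff.2 (mem_chart_source H p))
  rw [Set.image_singleton, isOpen_singleton_iff_punctured_nhds] at himage
  exact (PerfectSpace.not_isolated (chartAt H p p)).ne himage

section Saturation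

universe w

variable {X : Type*} [TopologicalSpace X] {r r' : ℕ} {E E' : X → Type w}
  [∀ p, AddCommGroup (E p)] [∀ p, Module ℂ (E p)] [∀ p, TopologicalSpace (E p)]
  [TopologicalSpace (TotalSpace (Fin r → ℂ) E)] [FiberBundle (Fin r → ℂ) E]
  [∀ p, AddCommGroup (E' p)] [∀ p, Module ℂ (E' p)]
  [TopologicalSpace (TotalSpace (Fin r' → ℂ) E')]

variable (r) in
/-- The saturation of a family of subspaces: the span of the values at `p` of the continuous
sections which lie in the family away from `p`. -/
def satFibre (K : ∀ p, Submodule ℂ (E p)) (p : X) : Submodule ℂ (E p) :=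
  Submodule.span ℂ {x | ∃ s : ∀ q, E q, s p = x ∧ ContinuousSectionAt r s p ∧
    ∀ᶠ q in 𝓝[≠] p, s q ∈ K q}

theorem satFibre_le_comap {K : ∀ p, Submodule ℂ (E p)} {K' : ∀ p, Submodule ℂ (E' p)}
    {T : FibreMap E E'} {W : Set X} {p : X} (hp : W ∈ 𝓝 p)
    (hT : ContinuousOn (T.total r r') {e | e.1 ∈ W}) (hTK : ∀ q, K q ≤ (K' q).comap (T q)) :
    satFibre r K p ≤ (satFibre r' K' p).comap (T p) := by
  rw [satFibre, Submodule.span_le]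
  rintro _ ⟨s, rfl, hs, hK⟩
  refine Submodule.subset_span ⟨fun q => T q (s q), rfl, ?_, hK.mono fun q hq => hTK q hq⟩
  have hmem : {e : TotalSpace (Fin r → ℂ) E | e.1 ∈ W} ∈ 𝓝 (⟨p, s p⟩ : TotalSpace _ E) :=
    (FiberBundle.continuous_proj (Fin r → ℂ) E).continuousAt hp
  exact ContinuousAt.comp (f := fun q => (⟨q, s q⟩ : TotalSpace _ E)) (hT.continuousAt hmem) hs

variable [VectorBundle ℂ (Fin r → ℂ) E] {k : ℕ} {s : ∀ q, E q} {t : Fin k → ∀ q, E q} {q : X}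

theorem ContinuousSectionAt.mem_span_of_frequently (hs : ContinuousSectionAt r s q)
    (ht : ∀ i, ContinuousSectionAt r (t i) q) (hind : LinearIndependent ℂ (fun i => t i q))
    (hmem : ∃ᶠ x in 𝓝 q, s x ∈ Submodule.span ℂ (Set.range fun i => t i x)) :
    s q ∈ Submodule.span ℂ (Set.range fun i => t i q) := by
  by_contra hnot
  let f : Fin (k + 1) → ∀ x, E x := Fin.cons s t
  have f_eq (x : X) : (fun i => f i x) = Fin.cons (s x) (fun i => t i x) :=
    funext fun i => Fin.cases rfl (fun i => rfl) i
  have hf (i : Fin (k + 1)) : ContinuousSectionAt r (f i) q := Fin.cases hs ht i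
  have f_indep : LinearIndependent ℂ (fun i => f i q) := by
    rw [f_eq]
    exact linearIndependent_finCons.2 ⟨hind, hnot⟩
  have hq : q ∈ coordSet r E q := mem_baseSet_trivializationAt (Fin r → ℂ) E q
  have hev := eventually_linearIndependent (fun i => (continuousSectionAt_iff hq).1 (hf i))
    (linearIndependent_coordMap hq f_indep)
  obtain ⟨x, hx, hxind⟩ := (hmem.and_eventually hev).exists
  have hxf : LinearIndependent ℂ (fun i => f i x) := LinearIndependent.of_comp _ hxind
  rw [f_eq, linearIndependent_finCons] at hxf
  exact hxf.2 hx

theorem satFibre_eq_span [(𝓝[≠] q).NeBot] {K : ∀ p, Submodule ℂ (E p)}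
    (ht : ∀ i, ContinuousSectionAt r (t i) q) (hind : LinearIndependent ℂ (fun i => t i q))
    (hK : ∀ᶠ x in 𝓝[≠] q, K x = Submodule.span ℂ (Set.range fun i => t i x)) :
    satFibre r K q = Submodule.span ℂ (Set.range fun i => t i q) := by
  apply le_antisymm
  · rw [satFibre, Submodule.span_le]
    rintro _ ⟨s, rfl, hs, hsK⟩
    have hspan : ∀ᶠ x in 𝓝[≠] q, s x ∈ Submodule.span ℂ (Set.range fun i => t i x) :=
      (hK.and hsK).mono fun x hx => hx.1 ▸ hx.2
    exact hs.mem_span_of_frequently ht hind (hspan.frequently.filter_mono nhdsWithin_le_nhds)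
  · rw [Submodule.span_le]
    rintro _ ⟨i, rfl⟩
    refine Submodule.subset_span ⟨t i, rfl, ht i, hK.mono fun x hx => ?_⟩
    rw [hx]
    exact Submodule.subset_span ⟨i, rfl⟩

end Saturation

section SaturatedKernelImage

universe w

variable {X : Type*} [TopologicalSpace X] [ChartedSpace ℂ X] {r r' : ℕ} {E E' : X → Type w}
  [∀ p, AddCommGroup (E p)] [∀ p, Module ℂ (E p)] [∀ p, TopologicalSpace (E p)]
  [TopologicalSpace (TotalSpace (Fin r → ℂ) E)] [FiberBundle (Fin r → ℂ) E]
  [∀ p, AddCommGroup (E' p)] [∀ p, Module ℂ (E' p)] [∀ p, TopologicalSpace (E' p)]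
  [TopologicalSpace (TotalSpace (Fin r' → ℂ) E')] [FiberBundle (Fin r' → ℂ) E']
  {T : FibreMap E E'} {p q : X} {k l : ℕ}

namespace AdaptedFrame

theorem chart_sub_ne_zero (A : AdaptedFrame r r' T p k l) (hq : q ∈ A.U) (hqp : q ≠ p) :
    chartAt ℂ p q - chartAt ℂ p p ≠ 0 := fun h =>
  hqp ((chartAt ℂ p).injOn (A.subset_source hq) (mem_chart_source ℂ p) (sub_eq_zero.1 h))

theorem linearIndependent_u (A : AdaptedFrame r r' T p k l) (hq : q ∈ A.U) :
    LinearIndependent ℂ (fun i => A.u i q) :=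
  (A.linearIndependent_source q hq).comp Sum.inr Sum.inr_injective

theorem eventually_mem_and_ne [T1Space X] (A : AdaptedFrame r r' T p k l) (hq : q ∈ A.U) :
    ∀ᶠ x in 𝓝[≠] q, x ∈ A.U ∧ x ≠ p := by
  refine (eventually_nhdsWithin_of_eventually_nhds (A.isOpen.mem_nhds hq)).and ?_
  obtain rfl | hqp := eq_or_ne q p
  exacts [self_mem_nhdsWithin, eventually_ne_nhdsWithin hqp]

theorem span_u_le_ker (A : AdaptedFrame r r' T p k l) (hq : q ∈ A.U) :
    Submodule.span ℂ (Set.range fun i => A.u i q) ≤ LinearMap.ker (T q) := by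
  rw [Submodule.span_le]
  rintro _ ⟨j, rfl⟩
  exact A.map_u q hq j

theorem span_w_le_range (A : AdaptedFrame r r' T p k l) (hq : q ∈ A.U) (hqp : q ≠ p) :
    Submodule.span ℂ (Set.range fun i => A.w i q) ≤ LinearMap.range (T q) := by
  rw [Submodule.span_le]
  rintro _ ⟨i, rfl⟩
  refine ⟨((chartAt ℂ p q - chartAt ℂ p p) ^ A.a i)⁻¹ • A.v i q, ?_⟩
  rw [map_smul, A.map_v q hq, inv_smul_smul₀ (pow_ne_zero _ (A.chart_sub_ne_zero hq hqp))]

variable [VectorBundle ℂ (Fin r → ℂ) E]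

theorem span_source_eq_top (A : AdaptedFrame r r' T p k l) (hq : q ∈ A.U) :
    Submodule.span ℂ (Set.range (Sum.elim (fun i => A.v i q) (fun i => A.u i q))) = ⊤ := by
  have := LinearEquiv.finiteDimensional (fibreEquiv r E q).symm
  refine (A.linearIndependent_source q hq).span_eq_top_of_card_eq_finrank' ?_
  simp only [Fintype.card_sum, Fintype.card_fin, finrank_fibre r E q, A.rank_add]

theorem exists_coeff (A : AdaptedFrame r r' T p k l) (hq : q ∈ A.U) (x : E q) :
    ∃ (c : Fin k → ℂ) (d : Fin l → ℂ), ∑ i, c i • A.v i q + ∑ j, d j • A.u j q = x ∧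
      T q x = ∑ i, (c i * (chartAt ℂ p q - chartAt ℂ p p) ^ A.a i) • A.w i q := by
  obtain ⟨c, hc⟩ := (Submodule.mem_span_range_iff_exists_fun ℂ).1
    ((A.span_source_eq_top hq).symm ▸ Submodule.mem_top (x := x))
  rw [Fintype.sum_sum_type] at hc
  refine ⟨fun i => c (Sum.inl i), fun j => c (Sum.inr j), hc, ?_⟩
  simp only [← hc, Sum.elim_inl, Sum.elim_inr, map_add, map_sum, map_smul, A.map_v q hq,
    A.map_u q hq, smul_smul, smul_zero, Finset.sum_const_zero, add_zero]

theorem range_le_span_w (A : AdaptedFrame r r' T p k l) (hq : q ∈ A.U) :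
    LinearMap.range (T q) ≤ Submodule.span ℂ (Set.range fun i => A.w i q) := by
  rintro _ ⟨x, rfl⟩
  obtain ⟨c, d, -, hT⟩ := A.exists_coeff hq x
  exact (Submodule.mem_span_range_iff_exists_fun ℂ).2 ⟨_, hT.symm⟩

theorem ker_eq (A : AdaptedFrame r r' T p k l) (hq : q ∈ A.U) (hqp : q ≠ p) :
    LinearMap.ker (T q) = Submodule.span ℂ (Set.range fun i => A.u i q) := by
  refine le_antisymm (fun x hx => ?_) (A.span_u_le_ker hq)
  obtain ⟨c, d, hcd, hT⟩ := A.exists_coeff hq x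
  rw [LinearMap.mem_ker.1 hx] at hT
  have hc (i) : c i = 0 :=
    (mul_eq_zero.1 (Fintype.linearIndependent_iff.1 (A.linearIndependent_w q hq) _ hT.symm i)
      ).resolve_right (pow_ne_zero _ (A.chart_sub_ne_zero hq hqp))
  refine (Submodule.mem_span_range_iff_exists_fun ℂ).2 ⟨d, ?_⟩
  simpa only [hc, zero_smul, Finset.sum_const_zero, zero_add] using hcd

theorem satFibre_ker [T1Space X] (A : AdaptedFrame r r' T p k l) (hq : q ∈ A.U) :
    satFibre r (fun q => LinearMap.ker (T q)) q =
      Submodule.span ℂ (Set.range fun i => A.u i q) := by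
  have := perfectSpace_of_chartedSpace ℂ (X := X)
  exact satFibre_eq_span
    (fun i => (A.holomorphic_u i).continuousSectionAt (A.isOpen.mem_nhds hq))
    (A.linearIndependent_u hq) ((A.eventually_mem_and_ne hq).mono fun x hx => A.ker_eq hx.1 hx.2)

theorem satFibre_range [VectorBundle ℂ (Fin r' → ℂ) E'] [T1Space X]
    (A : AdaptedFrame r r' T p k l) (hq : q ∈ A.U) :
    satFibre r' (fun q => LinearMap.range (T q)) q =
      Submodule.span ℂ (Set.range fun i => A.w i q) := by
  have := perfectSpace_of_chartedSpace ℂ (X := X)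
  exact satFibre_eq_span
    (fun i => (A.holomorphic_w i).continuousSectionAt (A.isOpen.mem_nhds hq))
    (A.linearIndependent_w q hq) ((A.eventually_mem_and_ne hq).mono fun x hx =>
      (A.range_le_span_w hx.1).antisymm (A.span_w_le_range hx.1 hx.2))

theorem isHolomorphicFrameOn_u [T1Space X] (A : AdaptedFrame r r' T p k l) :
    IsHolomorphicFrameOn r (satFibre r fun q => LinearMap.ker (T q)) A.u A.U :=
  ⟨A.isOpen, A.holomorphic_u, fun _ => A.linearIndependent_u, fun _ hq => (A.satFibre_ker hq).symm⟩

theorem isHolomorphicFrameOn_w [VectorBundle ℂ (Fin r' → ℂ) E'] [T1Space X]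
    (A : AdaptedFrame r r' T p k l) :
    IsHolomorphicFrameOn r' (satFibre r' fun q => LinearMap.range (T q)) A.w A.U :=
  ⟨A.isOpen, A.holomorphic_w, A.linearIndependent_w, fun _ hq => (A.satFibre_range hq).symm⟩

variable [T1Space X]

/-- The kernel of a holomorphic bundle morphism of constant generic rank, saturated to a
subbundle. -/
def saturatedKernel (A : ∀ p, AdaptedFrame r r' T p k l) : HolomorphicSubbundle r E where
  fibre := satFibre r (fun q => LinearMap.ker (T q))
  rank := l
  exists_frame p := ⟨(A p).U, (A p).u, (A p).mem, (A p).isHolomorphicFrameOn_u⟩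

/-- The image of a holomorphic bundle morphism of constant generic rank, saturated to a
subbundle. -/
def saturatedImage [VectorBundle ℂ (Fin r' → ℂ) E'] (A : ∀ p, AdaptedFrame r r' T p k l) :
    HolomorphicSubbundle r' E' where
  fibre := satFibre r' (fun q => LinearMap.range (T q))
  rank := k
  exists_frame p := ⟨(A p).U, (A p).w, (A p).mem, (A p).isHolomorphicFrameOn_w⟩

theorem finrank_satFibre_ker (A : AdaptedFrame r r' T p k l) (hq : q ∈ A.U) :
    Module.finrank ℂ (satFibre r (fun q => LinearMap.ker (T q)) q) = l := by
  rw [A.satFibre_ker hq, finrank_span_eq_card (A.linearIndependent_u hq), Fintype.card_fin]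

end AdaptedFrame

variable [T1Space X] [IsManifold 𝓘(ℂ, ℂ) ω X]
  [VectorBundle ℂ (Fin r → ℂ) E] [ContMDiffVectorBundle ω (Fin r → ℂ) E 𝓘(ℂ, ℂ)]
  [VectorBundle ℂ (Fin r' → ℂ) E'] [ContMDiffVectorBundle ω (Fin r' → ℂ) E' 𝓘(ℂ, ℂ)]

theorem isLocallyConstant_finrank_satFibre_ker (hT : IsHolomorphicMap r r' T) :
    IsLocallyConstant fun p =>
      Module.finrank ℂ (satFibre r (fun q => LinearMap.ker (T q)) p) := by
  refine IsLocallyConstant.iff_eventually_eq _ |>.2 fun p => ?_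
  obtain ⟨k, l, ⟨A⟩⟩ := exists_adaptedFrame hT p
  filter_upwards [A.isOpen.mem_nhds A.mem] with q hq
  rw [A.finrank_satFibre_ker hq, A.finrank_satFibre_ker A.mem]

theorem exists_forall_adaptedFrame [ConnectedSpace X] (hT : IsHolomorphicMap r r' T) :
    ∃ k l, ∀ p, Nonempty (AdaptedFrame r r' T p k l) := by
  obtain ⟨p₀⟩ := (inferInstance : Nonempty X)
  obtain ⟨k₀, l₀, ⟨A₀⟩⟩ := exists_adaptedFrame hT p₀
  refine ⟨k₀, l₀, fun p => ?_⟩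
  obtain ⟨k, l, ⟨A⟩⟩ := exists_adaptedFrame hT p
  obtain rfl : l = l₀ := by
    rw [← A.finrank_satFibre_ker A.mem, ← A₀.finrank_satFibre_ker A₀.mem]
    exact (isLocallyConstant_finrank_satFibre_ker hT).apply_eq_of_preconnectedSpace p p₀
  obtain rfl : k = k₀ := Nat.add_right_cancel (A.rank_add.trans A₀.rank_add.symm)
  exact ⟨A⟩

end SaturatedKernelImage

/-! ### Gram determinants of holomorphic frames and the Chern density -/

theorem exists_analyticAt_coeff {𝕜 ι F : Type*} [NontriviallyNormedField 𝕜] [CompleteSpace 𝕜]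
    [Fintype ι] [NormedAddCommGroup F] [NormedSpace 𝕜 F] [FiniteDimensional 𝕜 F]
    {f : ι → 𝕜 → F} {g : 𝕜 → F} {z : 𝕜} (hf : ∀ i, AnalyticAt 𝕜 (f i) z) (hg : AnalyticAt 𝕜 g z)
    (hind : LinearIndependent 𝕜 (fun i => f i z))
    (hmem : ∀ᶠ x in 𝓝 z, g x ∈ Submodule.span 𝕜 (Set.range fun i => f i x)) :
    ∃ p : 𝕜 → ι → 𝕜, AnalyticAt 𝕜 p z ∧ ∀ᶠ x in 𝓝 z, g x = ∑ i, p x i • f i x := by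
  classical
  obtain ⟨L, hL⟩ := LinearMap.exists_leftInverse_of_injective
    (Fintype.linearCombination 𝕜 (fun i => f i z))
    (LinearMap.ker_eq_bot.2 hind.fintypeLinearCombination_injective)
  let L' : F →L[𝕜] (ι → 𝕜) := LinearMap.toContinuousLinearMap L
  let B (x : 𝕜) : (ι → 𝕜) →L[𝕜] (ι → 𝕜) :=
    ∑ i, (ContinuousLinearMap.proj i : (ι → 𝕜) →L[𝕜] 𝕜).smulRight (L' (f i x))
  have B_apply (x : 𝕜) (p : ι → 𝕜) : B x p = L' (∑ i, p i • f i x) := by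
    simp only [B, sum_apply, ContinuousLinearMap.smulRight_apply,
      ContinuousLinearMap.proj_apply, map_sum, map_smul]
  have hB : AnalyticAt 𝕜 B z := Finset.analyticAt_fun_sum _ fun i _ =>
    (((ContinuousLinearMap.smulRightL 𝕜 (ι → 𝕜) (ι → 𝕜) (ContinuousLinearMap.proj i)).comp
      L').analyticAt _).comp (hf i)
  have hBz : B z = 1 := ContinuousLinearMap.ext fun p =>
    (B_apply z p).trans (LinearMap.congr_fun hL p)
  have hunit : ∀ᶠ x in 𝓝 z, IsUnit (B x) :=
    hB.continuousAt.eventually (Units.isOpen.mem_nhds (by simp [hBz]))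
  have hinv : AnalyticAt 𝕜 (fun x => Ring.inverse (B x)) z :=
    (analyticAt_inverse (𝕜 := 𝕜) hunit.self_of_nhds.unit).comp_of_eq hB rfl
  refine ⟨fun x => Ring.inverse (B x) (L' (g x)), analyticAt_clm_apply hinv
    ((L'.analyticAt _).comp hg), ?_⟩
  filter_upwards [hmem, hunit] with x hx hBx
  obtain ⟨p, hp⟩ := (Submodule.mem_span_range_iff_exists_fun 𝕜).1 hx
  have hp' : Ring.inverse (B x) (L' (g x)) = p := by
    rw [← hp, ← B_apply, ← mul_apply_eq_comp, Ring.inverse_mul_cancel _ hBx,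
      one_apply_eq_self]
  rw [hp', hp]

theorem core_inner_polarization {V : Type*} [AddCommGroup V] [Module ℂ V]
    (c : InnerProductSpace.Core ℂ V) (x y : V) :
    c.inner x y = (((c.inner (x + (1 : ℂ) • y) (x + (1 : ℂ) • y)).re : ℂ)
      - ((c.inner (x + (-1 : ℂ) • y) (x + (-1 : ℂ) • y)).re : ℂ)
      + (((c.inner (x + (-Complex.I) • y) (x + (-Complex.I) • y)).re : ℂ)
      - ((c.inner (x + Complex.I • y) (x + Complex.I • y)).re : ℂ)) * Complex.I) / 4 := by
  let : NormedAddCommGroup V := c.toNormedAddCommGroup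
  let : InnerProductSpace ℂ V := InnerProductSpace.ofCore c.toCore
  have normSq_eq (v : V) : ((c.inner v v).re : ℂ) = (‖v‖ : ℂ) ^ 2 := by
    exact_mod_cast inner_self_eq_norm_sq (𝕜 := ℂ) v
  simp only [normSq_eq, one_smul, neg_smul, ← sub_eq_add_neg]
  exact inner_eq_sum_norm_sq_div_four x y

theorem contDiff_re_det {ι : Type*} [Fintype ι] [DecidableEq ι] :
    ContDiff ℝ ∞ (fun A : ι → ι → ℂ => (Matrix.det (Matrix.of A)).re) := by
  refine Complex.reCLM.contDiff.comp ?_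
  simp only [Matrix.det_apply, Matrix.of_apply]
  refine ContDiff.sum fun σ _ => ContDiff.const_smul _ ?_
  exact contDiff_prod fun i _ => (contDiff_apply ℝ ℂ i).comp (contDiff_apply ℝ (ι → ℂ) (σ i))

theorem analyticAt_det {𝕜 E ι : Type*} [NontriviallyNormedField 𝕜] [NormedAddCommGroup E]
    [NormedSpace 𝕜 E] [Fintype ι] [DecidableEq ι] {A : E → Matrix ι ι 𝕜} {z : E}
    (hA : ∀ i j, AnalyticAt 𝕜 (fun x => A x i j) z) : AnalyticAt 𝕜 (fun x => (A x).det) z := by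
  simp only [Matrix.det_apply, Units.smul_def, zsmul_eq_mul]
  exact Finset.analyticAt_fun_sum _ fun σ _ => analyticAt_const.mul
    (Finset.analyticAt_fun_prod _ fun i _ => hA (σ i) i)

section Density

universe w

variable {X : Type*} [TopologicalSpace X] [ChartedSpace ℂ X] {r : ℕ} {E : X → Type w}
  [∀ p, TopologicalSpace (E p)]
  [TopologicalSpace (TotalSpace (Fin r → ℂ) E)] [FiberBundle (Fin r → ℂ) E]
  {s t : ∀ q, E q} {U : Set X} {p : X}

theorem IsHolomorphicSectionOn.contMDiffAt_real (hs : IsHolomorphicSectionOn r s U)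
    (hU : U ∈ 𝓝 p) :
    ContMDiffAt 𝓘(ℝ, ℂ) (modelR r) ∞ (fun q => (⟨q, s q⟩ : TotalSpace (Fin r → ℂ) E)) p := by
  have h := ContMDiffOn.contMDiffAt hs hU
  rw [contMDiffAt_iff] at h ⊢
  exact ⟨h.1, (ContDiffWithinAt.restrict_scalars ℝ h.2).of_le (by simp)⟩

variable [∀ p, AddCommGroup (E p)] [∀ p, Module ℂ (E p)]

theorem HermitianMetric.contMDiffAt_normSq (H : HermitianMetric r E)
    (hs : IsHolomorphicSectionOn r s U) (hU : U ∈ 𝓝 p) :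
    ContMDiffAt 𝓘(ℝ, ℂ) 𝓘(ℝ, ℝ) ∞ (fun q => ((H.core q).inner (s q) (s q)).re) p :=
  ContMDiffAt.comp (f := fun q => (⟨q, s q⟩ : TotalSpace (Fin r → ℂ) E)) p
    (H.smooth (⟨p, s p⟩ : TotalSpace (Fin r → ℂ) E)) (hs.contMDiffAt_real hU)

variable [VectorBundle ℂ (Fin r → ℂ) E]

theorem IsHolomorphicSectionOn.add_smul (hs : IsHolomorphicSectionOn r s U)
    (ht : IsHolomorphicSectionOn r t U) (c : ℂ) :
    IsHolomorphicSectionOn r (fun q => s q + c • t q) U :=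
  ContMDiffOn.add_section hs (ContMDiffOn.const_smul_section (a := c) ht)

theorem HermitianMetric.contMDiffAt_inner (H : HermitianMetric r E)
    (hs : IsHolomorphicSectionOn r s U) (ht : IsHolomorphicSectionOn r t U) (hU : U ∈ 𝓝 p) :
    ContMDiffAt 𝓘(ℝ, ℂ) 𝓘(ℝ, ℂ) ∞ (fun q => (H.core q).inner (s q) (t q)) p := by
  have contMDiffAt_normSq_add (c : ℂ) : ContMDiffAt 𝓘(ℝ, ℂ) 𝓘(ℝ, ℂ) ∞
      (fun q => (((H.core q).inner (s q + c • t q) (s q + c • t q)).re : ℂ)) p :=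
    (Complex.ofRealCLM.contDiff.contMDiff.contMDiffAt).comp p
      (H.contMDiffAt_normSq (hs.add_smul ht c) hU)
  have hP : ContDiff ℝ ∞ (fun v : Fin 4 → ℂ => (v 0 - v 1 + (v 2 - v 3) * Complex.I) / 4) := by
    fun_prop
  refine ((hP.contMDiff.contMDiffAt).comp p (contMDiffAt_pi_space.2 fun i =>
    contMDiffAt_normSq_add ((![1, -1, -Complex.I, Complex.I] : Fin 4 → ℂ) i))
    ).congr_of_eventuallyEq (Eventually.of_forall fun q => ?_)
  exact core_inner_polarization _ _ _

variable {ι : Type*} [Fintype ι] [DecidableEq ι]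

theorem HermitianMetric.contMDiffAt_gramDet (H : HermitianMetric r E) {s : ι → ∀ q, E q}
    (hs : ∀ i, IsHolomorphicSectionOn r (s i) U) (hU : U ∈ 𝓝 p) :
    ContMDiffAt 𝓘(ℝ, ℂ) 𝓘(ℝ, ℝ) ∞ (fun q => gramDet (H.core q) (fun i => s i q)) p :=
  (contDiff_re_det.contMDiff.contMDiffAt).comp p (contMDiffAt_pi_space.2 fun i =>
    contMDiffAt_pi_space.2 fun j => H.contMDiffAt_inner (hs i) (hs j) hU)

variable [IsManifold 𝓘(ℂ, ℂ) ω X] {c : X} {z : ℂ}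

theorem HermitianMetric.contDiffAt_log_gramDet (H : HermitianMetric r E) {s : ι → ∀ q, E q}
    (hs : ∀ i, IsHolomorphicSectionOn r (s i) U) (hz : z ∈ (chartAt ℂ c).target)
    (hU : U ∈ 𝓝 (chartInv c z)) (hind : LinearIndependent ℂ (fun i => s i (chartInv c z))) :
    ContDiffAt ℝ 2 (fun z' => Real.log (gramDet (H.core (chartInv c z'))
      (fun i => s i (chartInv c z')))) z :=
  ((contDiffAt_comp_chartInv hz (H.contMDiffAt_gramDet hs hU)).log
    (gramDet_pos _ hind).ne').of_le (WithTop.coe_le_coe.2 le_top)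

variable [ContMDiffVectorBundle ω (Fin r → ℂ) E 𝓘(ℂ, ℂ)] {k : ℕ} {S : ∀ p, Submodule ℂ (E p)}

theorem IsHolomorphicFrameOn.exists_transition {s t : Fin k → ∀ q, E q} {U U' : Set X}
    (hs : IsHolomorphicFrameOn r S s U) (ht : IsHolomorphicFrameOn r S t U')
    (hz : z ∈ (chartAt ℂ c).target) (hU : chartInv c z ∈ U) (hU' : chartInv c z ∈ U') :
    ∃ P : ℂ → Matrix (Fin k) (Fin k) ℂ, (∀ i j, AnalyticAt ℂ (fun z' => P z' i j) z) ∧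
      ∀ᶠ z' in 𝓝 z, ∀ i, t i (chartInv c z') = ∑ j, P z' i j • s j (chartInv c z') := by
  set q := chartInv c z
  have hq : q ∈ (chartAt ℂ c).source := (chartAt ℂ c).map_target hz
  have hqE : q ∈ coordSet r E q := mem_baseSet_trivializationAt (Fin r → ℂ) E q
  have hqz : chartAt ℂ c q = z := (chartAt ℂ c).right_inv hz
  have mem_nhds {W : Set X} (hW : IsOpen W) (hqW : q ∈ W) : ∀ᶠ z' in 𝓝 z, chartInv c z' ∈ W :=
    ((chartAt ℂ c).continuousAt_symm hz).eventually (hW.mem_nhds hqW)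
  have analyticAt_coord {s : ∀ q, E q} {W : Set X} (hs : IsHolomorphicSectionOn r s W)
      (hW : W ∈ 𝓝 q) :
      AnalyticAt ℂ (fun z' => coordMap r E q (chartInv c z') (s (chartInv c z'))) z := by
    have := hs.analyticAt hW hq hqE
    rwa [hqz] at this
  have exists_coeff (i : Fin k) := exists_analyticAt_coeff
    (fun j => analyticAt_coord (hs.holomorphic j) (hs.isOpen.mem_nhds hU))
    (analyticAt_coord (ht.holomorphic i) (ht.isOpen.mem_nhds hU'))
    (linearIndependent_coordMap hqE (hs.linearIndependent q hU)) <| by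
      filter_upwards [mem_nhds hs.isOpen hU, mem_nhds ht.isOpen hU'] with z' hzU hzU'
      rw [Set.range_comp' (coordMap r E q (chartInv c z')), Submodule.span_image,
        hs.span_eq _ hzU, ← ht.span_eq _ hzU']
      exact Submodule.mem_map_of_mem (Submodule.subset_span ⟨i, rfl⟩)
  choose P hP hPst using exists_coeff
  refine ⟨fun z' => Matrix.of fun i => P i z', fun i j =>
    (ContinuousLinearMap.proj (R := ℂ) (φ := fun _ : Fin k => ℂ) j).analyticAt _ |>.comp (hP i), ?_⟩
  filter_upwards [eventually_all.2 hPst,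
    mem_nhds (trivializationAt (Fin r → ℂ) E q).open_baseSet hqE] with z' hst hzE i
  rw [← coordSymm_coordMap hzE (t i _), hst]
  simp only [map_sum, map_smul, coordSymm_coordMap hzE, Matrix.of_apply]

theorem HermitianMetric.exists_harmonicAt_log_gramDet_eq_add (H : HermitianMetric r E)
    {s t : Fin k → ∀ q, E q} {U U' : Set X} (hs : IsHolomorphicFrameOn r S s U)
    (ht : IsHolomorphicFrameOn r S t U') (hz : z ∈ (chartAt ℂ c).target)
    (hU : chartInv c z ∈ U) (hU' : chartInv c z ∈ U') :
    ∃ f : ℂ → ℝ, InnerProductSpace.HarmonicAt f z ∧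
      ∀ᶠ z' in 𝓝 z,
        Real.log (gramDet (H.core (chartInv c z')) fun i => t i (chartInv c z')) =
          Real.log (gramDet (H.core (chartInv c z')) fun i => s i (chartInv c z')) + f z' := by
  obtain ⟨P, hP, hst⟩ := hs.exists_transition ht hz hU hU'
  have gramDet_eq {z' : ℂ}
      (h : ∀ i, t i (chartInv c z') = ∑ j, P z' i j • s j (chartInv c z')) :=
    gramDet_of_eq_sum (H.core (chartInv c z')) (P z') h
  have det_ne_zero : (P z).det ≠ 0 := fun h => by
    have hpos := gramDet_pos (H.core (chartInv c z)) (ht.linearIndependent _ hU')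
    rw [gramDet_eq hst.self_of_nhds, h, norm_zero] at hpos
    simp at hpos
  have hdet := analyticAt_det hP
  refine ⟨fun z' => 2 * Real.log ‖(P z').det‖,
    (hdet.harmonicAt_log_norm det_ne_zero).const_smul (c := (2 : ℝ)), ?_⟩
  filter_upwards [hst, hdet.continuousAt.eventually_ne det_ne_zero,
    ((chartAt ℂ c).continuousAt_symm hz).eventually (hs.isOpen.mem_nhds hU)] with z' hst hdet hzU
  have hpos := gramDet_pos (H.core (chartInv c z')) (hs.linearIndependent _ hzU)
  rw [gramDet_eq hst, Real.log_mul (by simpa using hdet) hpos.ne', Real.log_pow, add_comm,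
    Nat.cast_ofNat]

theorem HermitianMetric.chernDensity_eq (H : HermitianMetric r E) (S : HolomorphicSubbundle r E)
    {t : Fin S.rank → ∀ q, E q} (ht : IsHolomorphicFrameOn r S.fibre t U)
    (hz : z ∈ (chartAt ℂ c).target) (hU : chartInv c z ∈ U) :
    H.chernDensity S c z =
      -(1 / (4 * Real.pi)) * Δ (fun z' =>
        Real.log (gramDet (H.core (chartInv c z')) fun i => t i (chartInv c z'))) z := by
  obtain ⟨hmem, hframe⟩ := (S.exists_frame (chartInv c z)).choose_spec.choose_spec
  obtain ⟨f, hf, hft⟩ := H.exists_harmonicAt_log_gramDet_eq_add ht hframe hz hU hmem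
  rw [HermitianMetric.chernDensity, ← laplacian_add_harmonicAt
    (H.contDiffAt_log_gramDet ht.holomorphic hz (ht.isOpen.mem_nhds hU)
      (ht.linearIndependent _ hU)) hf]
  congr 1
  exact (InnerProductSpace.laplacian_congr_nhds hft).eq_of_nhds

theorem HermitianMetric.continuousOn_chernDensity (H : HermitianMetric r E)
    (S : HolomorphicSubbundle r E) (c : X) :
    ContinuousOn (H.chernDensity S c) (chartAt ℂ c).target := by
  refine fun z hz => ContinuousAt.continuousWithinAt ?_
  obtain ⟨U, t, hU, ht⟩ := S.exists_frame (chartInv c z)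
  have hlog := H.contDiffAt_log_gramDet ht.holomorphic hz (ht.isOpen.mem_nhds hU)
    (ht.linearIndependent _ hU)
  refine ((continuousAt_laplacian hlog).const_mul (-(1 / (4 * Real.pi)))).congr ?_
  filter_upwards [((chartAt ℂ c).continuousAt_symm hz).eventually (ht.isOpen.mem_nhds hU),
    (chartAt ℂ c).open_target.mem_nhds hz] with z' hzU hz'
  exact (H.chernDensity_eq S ht hz' hzU).symm

end Density

/-! ### The degree inequality -/

theorem finite_setOf_eq_zero {X M : Type*} [TopologicalSpace X] [CompactSpace X] [Zero M]
    {u : X → M} (hu : ∀ p, ∀ᶠ q in 𝓝[≠] p, u q ≠ 0) : {p | u p = 0}.Finite := by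
  by_contra hinf
  obtain ⟨p, hp⟩ := Set.Infinite.exists_accPt_principal hinf
  obtain ⟨q, ⟨hqp, hq⟩, hne⟩ :=
    ((accPt_iff_frequently.1 hp).and_eventually (eventually_nhdsWithin_iff.1 (hu p))).exists
  exact hne hqp hq

section LogPotential

variable {X : Type*} [TopologicalSpace X] [ChartedSpace ℂ X] {u : X → ℝ} {D : X → ℂ → ℝ} {a : ℝ}

theorem continuousOn_div_add_mul (hu : Continuous u) (hu₀ : ∀ p, 0 ≤ u p) {c : X}
    (hD : ContinuousOn (D c) (chartAt ℂ c).target) {ε : ℝ} (hε : 0 < ε) :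
    ContinuousOn (fun z => u (chartInv c z) / (u (chartInv c z) + ε) * D c z)
      (chartAt ℂ c).target := by
  have hu_chart : ContinuousOn (fun z => u (chartInv c z)) (chartAt ℂ c).target :=
    hu.comp_continuousOn (chartAt ℂ c).continuousOn_symm
  exact (hu_chart.div (hu_chart.add continuousOn_const)
    fun _ _ => (add_pos_of_nonneg_of_pos (hu₀ _) hε).ne').mul hD

variable [IsManifold 𝓘(ℂ, ℂ) ω X] [CompactSpace X] [T2Space X]

theorem surfaceIntegral_div_add_mul_nonneg (ha : 0 ≤ a) (hu : ContMDiff 𝓘(ℝ, ℂ) 𝓘(ℝ, ℝ) 2 u)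
    (hu₀ : ∀ p, 0 ≤ u p) (hDc : ∀ c, ContinuousOn (D c) (chartAt ℂ c).target)
    (hD : ∀ c, ∀ z ∈ (chartAt ℂ c).target, 0 < u (chartInv c z) →
      D c z = -a * Δ (fun z' => Real.log (u (chartInv c z'))) z) {ε : ℝ} (hε : 0 < ε) :
    0 ≤ surfaceIntegral fun c z => u (chartInv c z) / (u (chartInv c z) + ε) * D c z := by
  have hlog : ContMDiff 𝓘(ℝ, ℂ) 𝓘(ℝ, ℝ) 2 (fun p => Real.log (u p + ε)) := fun p =>
    ContMDiffAt.comp (f := fun p => u p + ε) p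
      (Real.contDiffAt_log.2 (add_pos_of_nonneg_of_pos (hu₀ p) hε).ne').contMDiffAt
      ((hu p).add contMDiffAt_const)
  calc 0 = surfaceIntegral fun c z => -a * Δ ((fun p => Real.log (u p + ε)) ∘ chartInv c) z := by
        rw [surfaceIntegral_const_mul, surfaceIntegral_laplacian hlog, mul_zero]
    _ ≤ _ := surfaceIntegral_mono
      (fun c => (continuousOn_laplacian_comp_chartInv hlog c).const_mul (-a))
      (fun c => continuousOn_div_add_mul hu.continuous hu₀ (hDc c) hε)
      fun c z hz => neg_mul_laplacian_log_add_le hε ha (contDiffAt_comp_chartInv hz (hu _))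
        (fun _ => hu₀ _) (hD c z hz)

theorem tendsto_surfaceIntegral_div_add_mul (hu : Continuous u) (hu₀ : ∀ p, 0 ≤ u p)
    (hne : ∀ p, ∀ᶠ q in 𝓝[≠] p, u q ≠ 0)
    (hD : ∀ c, ContinuousOn (D c) (chartAt ℂ c).target) :
    Tendsto (fun n : ℕ => surfaceIntegral fun c z =>
        u (chartInv c z) / (u (chartInv c z) + 1 / ((n : ℝ) + 1)) * D c z)
      atTop (𝓝 (surfaceIntegral D)) := by
  refine tendsto_surfaceIntegral
    (fun n c => continuousOn_div_add_mul hu hu₀ (hD c) Nat.one_div_pos_of_nat) hD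
    (fun n c z _ => ?_) fun c => ?_
  · have hε : (0 : ℝ) < 1 / ((n : ℝ) + 1) := Nat.one_div_pos_of_nat
    have hpos := add_pos_of_nonneg_of_pos (hu₀ (chartInv c z)) hε
    rw [abs_mul, abs_of_nonneg (div_nonneg (hu₀ _) hpos.le)]
    exact mul_le_of_le_one_left (abs_nonneg _)
      ((div_le_one hpos).2 (le_add_of_nonneg_right hε.le))
  · rw [ae_restrict_iff' (chartAt ℂ c).open_target.measurableSet]
    have hnull : volume (chartAt ℂ c '' {p | u p = 0}) = 0 :=
      ((finite_setOf_eq_zero hne).image _).measure_zero _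
    filter_upwards [compl_mem_ae_iff.2 hnull] with z hz hzT
    have hne : u (chartInv c z) ≠ 0 := fun h => hz ⟨_, h, (chartAt ℂ c).right_inv hzT⟩
    have hfactor : Tendsto (fun n : ℕ =>
        u (chartInv c z) / (u (chartInv c z) + 1 / ((n : ℝ) + 1))) atTop
        (𝓝 (u (chartInv c z) / (u (chartInv c z) + 0))) :=
      tendsto_const_nhds.div (tendsto_one_div_add_atTop_nhds_zero_nat.const_add _)
        (by rwa [add_zero])
    rw [add_zero, div_self hne] at hfactor
    simpa only [one_mul] using hfactor.mul_const (D c z)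

theorem surfaceIntegral_nonneg_of_log_potential (ha : 0 ≤ a)
    (hu : ContMDiff 𝓘(ℝ, ℂ) 𝓘(ℝ, ℝ) 2 u) (hu₀ : ∀ p, 0 ≤ u p)
    (hne : ∀ p, ∀ᶠ q in 𝓝[≠] p, u q ≠ 0)
    (hDc : ∀ c, ContinuousOn (D c) (chartAt ℂ c).target)
    (hD : ∀ c, ∀ z ∈ (chartAt ℂ c).target, 0 < u (chartInv c z) →
      D c z = -a * Δ (fun z' => Real.log (u (chartInv c z'))) z) :
    0 ≤ surfaceIntegral D :=
  ge_of_tendsto' (tendsto_surfaceIntegral_div_add_mul hu.continuous hu₀ hne hDc) fun _ =>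
    surfaceIntegral_div_add_mul_nonneg ha hu hu₀ hDc hD Nat.one_div_pos_of_nat

end LogPotential

section DegreeInequality

universe w

variable {X : Type*} [TopologicalSpace X] [ChartedSpace ℂ X] {r r' : ℕ} {E E' : X → Type w}
  [∀ p, AddCommGroup (E p)] [∀ p, Module ℂ (E p)] [∀ p, TopologicalSpace (E p)]
  [TopologicalSpace (TotalSpace (Fin r → ℂ) E)] [FiberBundle (Fin r → ℂ) E]
  [∀ p, AddCommGroup (E' p)] [∀ p, Module ℂ (E' p)] [∀ p, TopologicalSpace (E' p)]
  [TopologicalSpace (TotalSpace (Fin r' → ℂ) E')] [FiberBundle (Fin r' → ℂ) E']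
  {T : FibreMap E E'} {p q : X} {k l : ℕ}

namespace AdaptedFrame

/-- The frame of the source bundle made of `v` and `u`. -/
def source (A : AdaptedFrame r r' T p k l) (q : X) : Fin k ⊕ Fin l → E q :=
  Sum.elim (fun i => A.v i q) (fun i => A.u i q)

theorem isHolomorphicSectionOn_source (A : AdaptedFrame r r' T p k l) (i : Fin k ⊕ Fin l) :
    IsHolomorphicSectionOn r (fun q => A.source q i) A.U := by
  rcases i with i | i
  exacts [A.holomorphic_v i, A.holomorphic_u i]

theorem isHolomorphicFrameOn_source [VectorBundle ℂ (Fin r → ℂ) E]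
    (A : AdaptedFrame r r' T p k l) {n : ℕ} (e : Fin n ≃ Fin k ⊕ Fin l) :
    IsHolomorphicFrameOn r (fun _ => ⊤) (fun i q => A.source q (e i)) A.U where
  isOpen := A.isOpen
  holomorphic i := A.isHolomorphicSectionOn_source (e i)
  linearIndependent q hq := (A.linearIndependent_source q hq).comp e e.injective
  span_eq q hq := by
    rw [← A.span_source_eq_top hq]
    exact congrArg (Submodule.span ℂ) (e.surjective.range_comp (A.source q))

/-- The squared norm of the map `det (E / ker T) → det (im T)` induced by `T`, computed in an
adapted frame. -/
def ratio (A : AdaptedFrame r r' T p k l) (H : HermitianMetric r E) (H' : HermitianMetric r' E')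
    (q : X) : ℝ :=
  gramDet (H'.core q) (fun i => T q (A.v i q)) * gramDet (H.core q) (fun i => A.u i q) /
    gramDet (H.core q) (A.source q)

variable (H : HermitianMetric r E) (H' : HermitianMetric r' E')

theorem ratio_eq (A : AdaptedFrame r r' T p k l) (hq : q ∈ A.U) :
    A.ratio H H' q = ‖∏ i, (chartAt ℂ p q - chartAt ℂ p p) ^ A.a i‖ ^ 2 *
      (gramDet (H'.core q) (fun i => A.w i q) * gramDet (H.core q) (fun i => A.u i q) /
        gramDet (H.core q) (A.source q)) := by
  rw [ratio, funext (A.map_v q hq), gramDet_smul, mul_assoc, mul_div_assoc]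

theorem gramDet_w_mul_gramDet_u_div_pos (A : AdaptedFrame r r' T p k l) (hq : q ∈ A.U) :
    0 < gramDet (H'.core q) (fun i => A.w i q) * gramDet (H.core q) (fun i => A.u i q) /
      gramDet (H.core q) (A.source q) :=
  div_pos (mul_pos (gramDet_pos _ (A.linearIndependent_w q hq))
    (gramDet_pos _ (A.linearIndependent_u hq))) (gramDet_pos _ (A.linearIndependent_source q hq))

theorem ratio_nonneg (A : AdaptedFrame r r' T p k l) (hq : q ∈ A.U) : 0 ≤ A.ratio H H' q := by
  rw [A.ratio_eq H H' hq]
  exact mul_nonneg (sq_nonneg _) (A.gramDet_w_mul_gramDet_u_div_pos H H' hq).le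

theorem ratio_ne_zero (A : AdaptedFrame r r' T p k l) (hq : q ∈ A.U) (hqp : q ≠ p) :
    A.ratio H H' q ≠ 0 := by
  have hprod : ∏ i, (chartAt ℂ p q - chartAt ℂ p p) ^ A.a i ≠ 0 :=
    Finset.prod_ne_zero_iff.2 fun i _ => pow_ne_zero _ (A.chart_sub_ne_zero hq hqp)
  rw [A.ratio_eq H H' hq]
  exact mul_ne_zero (pow_ne_zero 2 (norm_ne_zero_iff.2 hprod))
    (A.gramDet_w_mul_gramDet_u_div_pos H H' hq).ne'

theorem a_eq_zero_of_ratio_ne_zero (A : AdaptedFrame r r' T p k l) (hp : A.ratio H H' p ≠ 0)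
    (i : Fin k) : A.a i = 0 := by
  by_contra hi
  refine hp ?_
  rw [A.ratio_eq H H' A.mem, Finset.prod_eq_zero (Finset.mem_univ i) (by simp [hi])]
  simp

theorem log_ratio (A : AdaptedFrame r r' T p k l) (hp : A.ratio H H' p ≠ 0) (hq : q ∈ A.U) :
    Real.log (A.ratio H H' q) = Real.log (gramDet (H'.core q) fun i => A.w i q)
      + Real.log (gramDet (H.core q) fun i => A.u i q)
      - Real.log (gramDet (H.core q) (A.source q)) := by
  have hw := (gramDet_pos (H'.core q) (A.linearIndependent_w q hq)).ne'
  have hu := (gramDet_pos (H.core q) (A.linearIndependent_u hq)).ne'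
  have hs : gramDet (H.core q) (A.source q) ≠ 0 :=
    (gramDet_pos (H.core q) (A.linearIndependent_source q hq)).ne'
  simp only [A.ratio_eq H H' hq, A.a_eq_zero_of_ratio_ne_zero H H' hp, pow_zero,
    Finset.prod_const_one, norm_one, one_pow, one_mul]
  rw [Real.log_div (mul_ne_zero hw hu) hs, Real.log_mul hw hu]

variable [VectorBundle ℂ (Fin r → ℂ) E]

theorem ratio_eq_ratio [T1Space X] {p' : X} (A : AdaptedFrame r r' T p k l)
    (A' : AdaptedFrame r r' T p' k l) (hq : q ∈ A.U) (hq' : q ∈ A'.U) :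
    A'.ratio H H' q = A.ratio H H' q := by
  refine gramDet_map_mul_gramDet_div_eq _ _ (A.map_u q hq) (A'.linearIndependent_source q hq')
    (fun _ => (A.span_source_eq_top hq).symm ▸ Submodule.mem_top) fun j => ?_
  rw [← A.satFibre_ker hq, A'.satFibre_ker hq']
  exact Submodule.subset_span ⟨j, rfl⟩

theorem contMDiffAt_ratio [VectorBundle ℂ (Fin r' → ℂ) E'] (A : AdaptedFrame r r' T p k l)
    (hT : IsHolomorphicMap r r' T) (hq : q ∈ A.U) :
    ContMDiffAt 𝓘(ℝ, ℂ) 𝓘(ℝ, ℝ) ∞ (A.ratio H H') q := by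
  have hU := A.isOpen.mem_nhds hq
  exact ((H'.contMDiffAt_gramDet (fun i => hT.comp_section (A.holomorphic_v i)) hU).mul
    (H.contMDiffAt_gramDet A.holomorphic_u hU)).div₀
    (H.contMDiffAt_gramDet A.isHolomorphicSectionOn_source hU)
    (gramDet_pos _ (A.linearIndependent_source q hq)).ne'

/-- The squared norm of the map `det (E / ker T) → det (im T)` as a function on all of `X`. -/
def globalRatio (A : ∀ p, AdaptedFrame r r' T p k l) (p : X) : ℝ :=
  (A p).ratio H H' p

section GlobalRatio

variable [T1Space X] (A : ∀ p, AdaptedFrame r r' T p k l)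

theorem globalRatio_eventuallyEq (p : X) : globalRatio H H' A =ᶠ[𝓝 p] (A p).ratio H H' :=
  Filter.mem_of_superset ((A p).isOpen.mem_nhds (A p).mem) fun q hq =>
    ratio_eq_ratio H H' (A p) (A q) hq (A q).mem

theorem contMDiff_globalRatio [VectorBundle ℂ (Fin r' → ℂ) E'] (hT : IsHolomorphicMap r r' T) :
    ContMDiff 𝓘(ℝ, ℂ) 𝓘(ℝ, ℝ) ∞ (globalRatio H H' A) := fun p =>
  ((A p).contMDiffAt_ratio H H' hT (A p).mem).congr_of_eventuallyEq
    (globalRatio_eventuallyEq H H' A p)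

theorem eventually_globalRatio_ne_zero (p : X) : ∀ᶠ q in 𝓝[≠] p, globalRatio H H' A q ≠ 0 := by
  filter_upwards [(A p).eventually_mem_and_ne (A p).mem,
    (globalRatio_eventuallyEq H H' A p).filter_mono nhdsWithin_le_nhds] with q hq heq
  exact heq ▸ (A p).ratio_ne_zero H H' hq.1 hq.2

end GlobalRatio

variable [IsManifold 𝓘(ℂ, ℂ) ω X] [ContMDiffVectorBundle ω (Fin r → ℂ) E 𝓘(ℂ, ℂ)]

theorem chernDensity_whole_eq (A : AdaptedFrame r r' T p k l) {c : X} {z : ℂ}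
    (hz : z ∈ (chartAt ℂ c).target) (hU : chartInv c z ∈ A.U) :
    H.chernDensity (.whole r E) c z = -(1 / (4 * Real.pi)) * Δ (fun z' =>
      Real.log (gramDet (H.core (chartInv c z')) (A.source (chartInv c z')))) z := by
  let e : Fin r ≃ Fin k ⊕ Fin l := (finCongr A.rank_add.symm).trans finSumFinEquiv.symm
  rw [H.chernDensity_eq (.whole r E) (A.isHolomorphicFrameOn_source e) hz hU]
  simp only [← gramDet_comp_equiv _ (A.source _) e]
  rfl

variable [VectorBundle ℂ (Fin r' → ℂ) E'] [ContMDiffVectorBundle ω (Fin r' → ℂ) E' 𝓘(ℂ, ℂ)]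

theorem chernDensity_add_sub [T1Space X] (A : ∀ p, AdaptedFrame r r' T p k l) {c : X} {z : ℂ}
    (hz : z ∈ (chartAt ℂ c).target)
    (hne : (A (chartInv c z)).ratio H H' (chartInv c z) ≠ 0) :
    H.chernDensity (saturatedKernel A) c z + H'.chernDensity (saturatedImage A) c z -
        H.chernDensity (.whole r E) c z =
      -(1 / (4 * Real.pi)) *
        Δ (fun z' => Real.log ((A (chartInv c z)).ratio H H' (chartInv c z'))) z := by
  set B := A (chartInv c z)
  have hU := B.isOpen.mem_nhds B.mem
  let log_u (z' : ℂ) := Real.log (gramDet (H.core (chartInv c z')) fun i => B.u i (chartInv c z'))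
  let log_w (z' : ℂ) := Real.log (gramDet (H'.core (chartInv c z')) fun i => B.w i (chartInv c z'))
  let log_s (z' : ℂ) := Real.log (gramDet (H.core (chartInv c z')) (B.source (chartInv c z')))
  have log_u_smooth : ContDiffAt ℝ 2 log_u z :=
    H.contDiffAt_log_gramDet B.holomorphic_u hz hU (B.linearIndependent_u B.mem)
  have log_w_smooth : ContDiffAt ℝ 2 log_w z :=
    H'.contDiffAt_log_gramDet B.holomorphic_w hz hU (B.linearIndependent_w _ B.mem)
  have log_s_smooth : ContDiffAt ℝ 2 log_s z :=
    H.contDiffAt_log_gramDet B.isHolomorphicSectionOn_source hz hU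
      (B.linearIndependent_source _ B.mem)
  have log_ratio_eq : (fun z' => Real.log (B.ratio H H' (chartInv c z'))) =ᶠ[𝓝 z]
      log_w + log_u - log_s :=
    (((chartAt ℂ c).continuousAt_symm hz).eventually hU).mono fun _ => B.log_ratio H H' hne
  have density_ker : H.chernDensity (saturatedKernel A) c z = -(1 / (4 * Real.pi)) * Δ log_u z :=
    H.chernDensity_eq (saturatedKernel A) B.isHolomorphicFrameOn_u hz B.mem
  have density_im : H'.chernDensity (saturatedImage A) c z = -(1 / (4 * Real.pi)) * Δ log_w z :=
    H'.chernDensity_eq (saturatedImage A) B.isHolomorphicFrameOn_w hz B.mem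
  have log_sum_smooth : ContDiffAt ℝ 2 (log_w + log_u) z := log_w_smooth.add log_u_smooth
  rw [density_ker, density_im, B.chernDensity_whole_eq H hz B.mem,
    (InnerProductSpace.laplacian_congr_nhds log_ratio_eq).eq_of_nhds,
    log_sum_smooth.laplacian_sub log_s_smooth, log_w_smooth.laplacian_add log_u_smooth]
  ring

theorem chernDensity_add_sub_eq_laplacian_log_globalRatio [T1Space X]
    (A : ∀ p, AdaptedFrame r r' T p k l) {c : X} {z : ℂ}
    (hz : z ∈ (chartAt ℂ c).target) (hne : globalRatio H H' A (chartInv c z) ≠ 0) :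
    H.chernDensity (saturatedKernel A) c z + H'.chernDensity (saturatedImage A) c z -
        H.chernDensity (.whole r E) c z =
      -(1 / (4 * Real.pi)) * Δ (fun z' => Real.log (globalRatio H H' A (chartInv c z'))) z := by
  have heq : globalRatio H H' A ∘ chartInv c =ᶠ[𝓝 z]
      (A (chartInv c z)).ratio H H' ∘ chartInv c :=
    (globalRatio_eventuallyEq H H' A (chartInv c z)).comp_tendsto
      ((chartAt ℂ c).continuousAt_symm hz)
  rw [chernDensity_add_sub H H' A hz hne]
  exact congrArg (_ * ·)
    (InnerProductSpace.laplacian_congr_nhds (heq.fun_comp Real.log)).eq_of_nhds.symm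

theorem degree_whole_le [CompactSpace X] [T2Space X] (hT : IsHolomorphicMap r r' T)
    (A : ∀ p, AdaptedFrame r r' T p k l) :
    (HolomorphicSubbundle.whole r E).degree ≤
      (saturatedKernel A).degree + (saturatedImage A).degree := by
  let H := (nonempty_hermitianMetric r E).some
  let H' := (nonempty_hermitianMetric r' E').some
  have hS := H.continuousOn_chernDensity (saturatedKernel A)
  have hI := H'.continuousOn_chernDensity (saturatedImage A)
  have hE := H.continuousOn_chernDensity (.whole r E)
  have hnonneg : 0 ≤ surfaceIntegral fun c z => H.chernDensity (saturatedKernel A) c z +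
      H'.chernDensity (saturatedImage A) c z - H.chernDensity (.whole r E) c z :=
    surfaceIntegral_nonneg_of_log_potential
      (one_div_nonneg.2 (mul_nonneg zero_le_four Real.pi_nonneg))
      ((contMDiff_globalRatio H H' A hT).of_le (WithTop.coe_le_coe.2 le_top))
      (fun p => (A p).ratio_nonneg H H' (A p).mem) (eventually_globalRatio_ne_zero H H' A)
      (fun c => ((hS c).add (hI c)).sub (hE c)) fun c z hz hpos =>
        chernDensity_add_sub_eq_laplacian_log_globalRatio H H' A hz hpos.ne'
  have hSI (c : X) : ContinuousOn (fun z => H.chernDensity (saturatedKernel A) c z +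
      H'.chernDensity (saturatedImage A) c z) (chartAt ℂ c).target := (hS c).add (hI c)
  rw [surfaceIntegral_sub hSI hE, surfaceIntegral_add hS hI] at hnonneg
  exact sub_nonneg.1 hnonneg

end AdaptedFrame

end DegreeInequality

/-! ### Eigenvalues of endomorphisms -/

section Endomorphism

universe w

variable {X : Type*} [TopologicalSpace X] {r : ℕ} {E : X → Type w}
  [∀ p, AddCommGroup (E p)] [∀ p, Module ℂ (E p)] [∀ p, TopologicalSpace (E p)]
  [TopologicalSpace (TotalSpace (Fin r → ℂ) E)] [FiberBundle (Fin r → ℂ) E]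
  [VectorBundle ℂ (Fin r → ℂ) E] {f : FibreMap E E}

theorem det_coordHom {p q : X} (hq : q ∈ coordSet r E p) :
    LinearMap.det (coordHom r r f p q : (Fin r → ℂ) →ₗ[ℂ] Fin r → ℂ) = LinearMap.det (f q) :=
  LinearMap.det_conj (f q) (LinearEquiv.ofLinearMap (coordMap r E p q) (coordSymm r E p q)
    (LinearMap.ext (coordMap_coordSymm hq)) (LinearMap.ext (coordSymm_coordMap hq)))

variable [ChartedSpace ℂ X] [ContMDiffVectorBundle ω (Fin r → ℂ) E 𝓘(ℂ, ℂ)]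

theorem IsHolomorphicMap.sub_smul_id (hf : IsHolomorphicMap r r f) (c : ℂ) :
    IsHolomorphicMap r r (fun p => f p - c • (LinearMap.id : E p →ₗ[ℂ] E p)) := by
  intro x
  let e := trivializationAt (Fin r → ℂ) E x.1
  have hx : x.1 ∈ e.baseSet := mem_baseSet_trivializationAt _ _ _
  have f_coord := (e.contMDiffAt_iff (IM := modelC r) (IB := 𝓘(ℂ, ℂ)) (n := ω)
    (f := FibreMap.total r r f) (e.mem_source.2 hx)).1 (hf x)
  have id_coord := (e.contMDiffAt_iff (IM := modelC r) (IB := 𝓘(ℂ, ℂ)) (n := ω)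
    (f := (id : TotalSpace (Fin r → ℂ) E → _)) (e.mem_source.2 hx)).1 contMDiffAt_id
  refine (e.contMDiffAt_iff (e.mem_source.2 hx)).2 ⟨f_coord.1, ?_⟩
  refine (f_coord.2.sub ((contDiff_const_smul c).contMDiff.contMDiffAt.comp x id_coord.2)
    ).congr_of_eventuallyEq ?_
  filter_upwards [e.open_source.mem_nhds (e.mem_source.2 hx)] with y hy
  have hy : y.1 ∈ coordSet r E x.1 := e.mem_source.1 hy
  change (e ⟨y.1, f y.1 y.2 - c • y.2⟩).2 = (e ⟨y.1, f y.1 y.2⟩).2 - c • (e ⟨y.1, y.2⟩).2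
  simp only [e, ← coordMap_apply hy, map_sub, map_smul]

variable [IsManifold 𝓘(ℂ, ℂ) ω X]

theorem mdifferentiable_det (hf : IsHolomorphicMap r r f) :
    MDifferentiable 𝓘(ℂ, ℂ) 𝓘(ℂ, ℂ) (fun p => LinearMap.det (f p)) := by
  intro p
  have hp := mem_chart_source ℂ p
  have hpE : p ∈ coordSet r E p := mem_baseSet_trivializationAt (Fin r → ℂ) E p
  have hdet : AnalyticAt ℂ (fun z => (LinearMap.toMatrix' (coordHom r r f p (chartInv p z) :
      (Fin r → ℂ) →ₗ[ℂ] Fin r → ℂ)).det) (chartAt ℂ p p) := by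
    refine analyticAt_det fun i j => ?_
    simp only [LinearMap.toMatrix'_apply]
    exact ((ContinuousLinearMap.proj (R := ℂ) (φ := fun _ : Fin r => ℂ) i).analyticAt _).comp
      (analyticAt_clm_apply (analyticAt_coordHom hf hp hpE hpE) analyticAt_const)
  refine ((contMDiffAt_comp_chart hp hdet).congr_of_eventuallyEq ?_).mdifferentiableAt
    (by simp)
  filter_upwards [(chartAt ℂ p).open_source.mem_nhds hp,
    (trivializationAt (Fin r → ℂ) E p).open_baseSet.mem_nhds hpE] with q hq hqE
  simp only [Function.comp_apply, chartInv, (chartAt ℂ p).left_inv hq, LinearMap.det_toMatrix',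
    det_coordHom hqE]

theorem IsHolomorphicMap.exists_forall_hasEigenvalue [CompactSpace X] [ConnectedSpace X]
    (hf : IsHolomorphicMap r r f) (hr : r ≠ 0) :
    ∃ c : ℂ, ∀ p, Module.End.HasEigenvalue (f p) c := by
  have (p : X) := LinearEquiv.finiteDimensional (fibreEquiv r E p).symm
  have eigenvalue_iff (c : ℂ) (p : X) :
      Module.End.HasEigenvalue (f p) c ↔ LinearMap.det (f p - c • LinearMap.id) = 0 := by
    rw [Module.End.hasEigenvalue_iff, Module.End.eigenspace_def,
      ← LinearMap.det_eq_zero_iff_ker_ne_bot]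
    rfl
  obtain ⟨p₀⟩ := (inferInstance : Nonempty X)
  have : Nontrivial (E p₀) := Module.nontrivial_of_finrank_pos (R := ℂ) <| by
    rw [finrank_fibre r E p₀]
    exact Nat.pos_of_ne_zero hr
  obtain ⟨c, hc⟩ := Module.End.exists_eigenvalue (f p₀)
  refine ⟨c, fun p => (eigenvalue_iff c p).2 ?_⟩
  -- The holomorphic function `det (f - c)` is constant on the compact connected surface.
  rw [(mdifferentiable_det (hf.sub_smul_id c)).apply_eq_of_compactSpace p p₀]
  exact (eigenvalue_iff c p₀).1 hc

end Endomorphism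

/-! ### Ranks of subbundles -/

section Rank

universe w

variable {X : Type*} [TopologicalSpace X] [ChartedSpace ℂ X] {r r' : ℕ} {E E' : X → Type w}
  [∀ p, AddCommGroup (E p)] [∀ p, Module ℂ (E p)] [∀ p, TopologicalSpace (E p)]
  [TopologicalSpace (TotalSpace (Fin r → ℂ) E)] [FiberBundle (Fin r → ℂ) E]
  [∀ p, AddCommGroup (E' p)] [∀ p, Module ℂ (E' p)] [∀ p, TopologicalSpace (E' p)]
  [TopologicalSpace (TotalSpace (Fin r' → ℂ) E')] [FiberBundle (Fin r' → ℂ) E']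
  {T : FibreMap E E'} {p q : X} {k l : ℕ}

theorem HolomorphicSubbundle.finrank_fibre (S : HolomorphicSubbundle r E) (p : X) :
    Module.finrank ℂ (S.fibre p) = S.rank := by
  obtain ⟨U, s, hU, hs⟩ := S.exists_frame p
  rw [← hs.span_eq p hU, finrank_span_eq_card (hs.linearIndependent p hU), Fintype.card_fin]

theorem HolomorphicSubbundle.fibre_ne_bot (S : HolomorphicSubbundle r E) (hS : S.rank ≠ 0)
    (p : X) : S.fibre p ≠ ⊥ := fun h =>
  hS (by rw [← S.finrank_fibre p, h, finrank_bot])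

variable [VectorBundle ℂ (Fin r → ℂ) E]

theorem HolomorphicSubbundle.fibre_ne_top (S : HolomorphicSubbundle r E) (hS : S.rank ≠ r)
    (p : X) : S.fibre p ≠ ⊤ := fun h =>
  hS (by rw [← S.finrank_fibre p, h, finrank_top, QbarBundle.finrank_fibre r E p])

theorem AdaptedFrame.rank_ker_ne_zero [T1Space X] (A : AdaptedFrame r r' T p k l)
    (hker : ∀ q, LinearMap.ker (T q) ≠ ⊥) : l ≠ 0 := by
  rintro rfl
  have := perfectSpace_of_chartedSpace ℂ (X := X)
  obtain ⟨q, hq, hqp⟩ := (A.eventually_mem_and_ne A.mem).exists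
  exact hker q (by rw [A.ker_eq hq hqp, Set.range_eq_empty, Submodule.span_empty])

theorem AdaptedFrame.rank_range_ne_zero (A : AdaptedFrame r r' T p k l) (hq : q ∈ A.U)
    (hT : T q ≠ 0) : k ≠ 0 := by
  rintro rfl
  refine hT (LinearMap.range_eq_bot.1 (le_bot_iff.1 ?_))
  simpa only [Set.range_eq_empty, Submodule.span_empty] using A.range_le_span_w hq

end Rank

/-! ### Invariance under forms -/

section Commute

variable {R M N : Type*} [Semiring R] [AddCommMonoid M] [Module R M] [AddCommMonoid N] [Module R N]
  {T : M →ₗ[R] N} {g : M →ₗ[R] M} {g' : N →ₗ[R] N}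

theorem ker_le_comap_ker_of_comm (h : g' ∘ₗ T = T ∘ₗ g) :
    LinearMap.ker g ≤ (LinearMap.ker g').comap T := by
  rw [← LinearMap.ker_comp, h]
  exact LinearMap.ker_le_ker_comp g T

theorem range_le_comap_range_of_comm (h : g' ∘ₗ T = T ∘ₗ g) :
    LinearMap.range g ≤ (LinearMap.range g').comap T := by
  rw [← Submodule.map_le_iff_le_comap, ← LinearMap.range_comp, ← h]
  exact LinearMap.range_comp_le_range T g'

end Commute

theorem alternatingMap_two_apply_smul_add_smul {R M N : Type*} [CommRing R] [AddCommGroup M]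
    [Module R M] [AddCommGroup N] [Module R N] (y : M [⋀^Fin 2]→ₗ[R] N) (v w : M) (a b a' b' : R) :
    y ![a • v + b • w, a' • v + b' • w] = (a * b' - b * a') • y ![v, w] := by
  have apply_left (a b : R) (z : M) :
      y ![a • v + b • w, z] = a • y ![v, z] + b • y ![w, z] := by
    rw [y.map_vecCons_add, y.map_vecCons_smul, y.map_vecCons_smul]
  have apply_self (z : M) : y ![z, z] = 0 :=
    y.map_eq_zero_of_eq ![z, z] (i := 0) (j := 1) rfl zero_ne_one
  have apply_swap (z z' : M) : y ![z, z'] = -y ![z', z] := by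
    rw [← y.map_swap ![z', z] (zero_ne_one (α := Fin 2))]
    congr 1
    ext i
    fin_cases i <;> rfl
  rw [apply_left, apply_swap v, apply_swap w, apply_left, apply_left, apply_self, apply_self,
    apply_swap w v]
  module

section Forms

universe w

variable {X : Type*} [TopologicalSpace X] [ChartedSpace ℂ X] [IsManifold 𝓘(ℂ, ℂ) ω X] {p : X}

theorem exists_smul_coordField_eq (t : TangentSpace 𝓘(ℂ, ℂ) p) :
    ∃ a : ℂ, a • coordField p p = t := by
  let e := trivializationAt ℂ (TangentSpace 𝓘(ℂ, ℂ) : X → Type) p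
  have hp : p ∈ e.baseSet := mem_baseSet_trivializationAt _ _ _
  have coordField_eq : coordField p p = e.symmₗ ℂ p 1 := (e.symmₗ_apply hp 1).symm
  refine ⟨e.linearMapAt ℂ p t, ?_⟩
  rw [coordField_eq, ← map_smul, smul_eq_mul, mul_one, e.symmₗ_linearMapAt hp]

variable {r r' : ℕ} {E E' : X → Type w}
  [∀ p, AddCommGroup (E p)] [∀ p, Module ℂ (E p)] [∀ p, TopologicalSpace (E p)]
  [TopologicalSpace (TotalSpace (Fin r → ℂ) E)] [FiberBundle (Fin r → ℂ) E]
  [∀ p, AddCommGroup (E' p)] [∀ p, Module ℂ (E' p)] [∀ p, TopologicalSpace (E' p)]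
  [TopologicalSpace (TotalSpace (Fin r' → ℂ) E')] [FiberBundle (Fin r' → ℂ) E']
  {K : ∀ p, Submodule ℂ (E p)} {K' : ∀ p, Submodule ℂ (E' p)}

theorem satFibre_le_comap_oneForm {φ : OneForm E E'} (hφ : φ.IsSmooth r r')
    (hK : ∀ q t, K q ≤ (K' q).comap (φ q t)) (t : TangentSpace 𝓘(ℂ, ℂ) p) :
    satFibre r K p ≤ (satFibre r' K' p).comap (φ p t) := by
  have hcoord := satFibre_le_comap (T := fun q => φ q (coordField p q))
    (chart_source_mem_nhds ℂ p) (hφ p).continuousOn fun q => hK q _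
  obtain ⟨a, rfl⟩ := exists_smul_coordField_eq t
  intro x hx
  rw [Submodule.mem_comap, map_smul]
  exact Submodule.smul_mem _ a (hcoord hx)

theorem satFibre_le_comap_twoForm {y : TwoForm E E'} (hy : y.IsSmooth r r')
    (hK : ∀ q t, K q ≤ (K' q).comap (y q t)) (t : Fin 2 → TangentSpace 𝓘(ℂ, ℂ) p) :
    satFibre r K p ≤ (satFibre r' K' p).comap (y p t) := by
  have hcoord := satFibre_le_comap
    (T := fun q => y q ![coordField p q, Complex.I • coordField p q])
    (chart_source_mem_nhds ℂ p) (hy p).continuousOn fun q => hK q _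
  have smul_coordField (c : ℂ) : c • coordField p p =
      c.re • coordField p p + c.im • (Complex.I • coordField p p) := by
    conv_lhs => rw [← Complex.re_add_im c, add_smul, mul_smul]
    rfl
  obtain ⟨a, ha⟩ := exists_smul_coordField_eq (t 0)
  obtain ⟨b, hb⟩ := exists_smul_coordField_eq (t 1)
  have ht : t = ![a • coordField p p, b • coordField p p] := by
    ext i
    fin_cases i
    exacts [ha.symm, hb.symm]
  intro x hx
  rw [Submodule.mem_comap, ht, smul_coordField a, smul_coordField b,
    alternatingMap_two_apply_smul_add_smul]
  exact Submodule.smul_mem _ ((a.re * b.im - a.im * b.re : ℝ) : ℂ) (hcoord hx)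

end Forms

/-! ### Stable bundles on the double quiver -/

theorem add_div_add_le_max_div {α : Type*} [Field α] [LinearOrder α] [IsStrictOrderedRing α]
    {a b c d : α} (hc : 0 < c) (hd : 0 < d) : (a + b) / (c + d) ≤ max (a / c) (b / d) := by
  rw [div_le_iff₀ (add_pos hc hd), mul_add]
  exact add_le_add ((div_le_iff₀ hc).1 (le_max_left _ _)) ((div_le_iff₀ hd).1 (le_max_right _ _))

section Quiver

universe w

variable {X : Type*} [TopologicalSpace X] [ChartedSpace ℂ X] [IsManifold 𝓘(ℂ, ℂ) ω X]
  {V : Type*} {r : V → ℕ} {E : V → X → Type w}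
  [∀ v p, AddCommGroup (E v p)] [∀ v p, Module ℂ (E v p)] [∀ v p, TopologicalSpace (E v p)]
  [∀ v, TopologicalSpace (TotalSpace (Fin (r v) → ℂ) (E v))]
  [∀ v, FiberBundle (Fin (r v) → ℂ) (E v)]

section Subbundle

variable [Quiver V] {R : Rep r E} {g : ∀ v, FibreMap (E v) (E v)} {k l : V → ℕ}

theorem Rep.isSubbundle_of_fibre_eq_satFibre {K : ∀ v p, Submodule ℂ (E v p)}
    {S : ∀ v, HolomorphicSubbundle (r v) (E v)} (hS : ∀ v, (S v).fibre = satFibre (r v) (K v))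
    (hφ : ∀ v p t, K v p ≤ (K v p).comap (R.φ v p t))
    (hx : ∀ {i j : V} (a : i ⟶ j) p, K i p ≤ (K j p).comap (R.x a p))
    (hy : ∀ {i j : V} (a : i ⟶ j) p t, K j p ≤ (K i p).comap (R.y a p t)) :
    R.IsSubbundle S where
  map_φ v _ t := by
    simpa only [hS] using satFibre_le_comap_oneForm (R.φ_smooth v) (hφ v) t
  map_x a _ := by
    simpa only [hS] using satFibre_le_comap univ_mem
      (R.x_holomorphic a).continuous.continuousOn (hx a)
  map_y a _ t := by
    simpa only [hS] using satFibre_le_comap_twoForm (R.y_smooth a) (hy a) t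

variable [∀ v, VectorBundle ℂ (Fin (r v) → ℂ) (E v)]

theorem IsMorphism.isSubbundle_saturatedKernel [T1Space X] (hg : IsMorphism R R g)
    (A : ∀ v p, AdaptedFrame (r v) (r v) (g v) p (k v) (l v)) :
    R.IsSubbundle fun v => AdaptedFrame.saturatedKernel (A v) :=
  Rep.isSubbundle_of_fibre_eq_satFibre (fun _ => rfl)
    (fun v p t => ker_le_comap_ker_of_comm (hg.comm_φ v p t))
    (fun a p => ker_le_comap_ker_of_comm (hg.comm_x a p))
    fun a p t => ker_le_comap_ker_of_comm (hg.comm_y a p t)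

theorem IsMorphism.isSubbundle_saturatedImage [T1Space X] (hg : IsMorphism R R g)
    (A : ∀ v p, AdaptedFrame (r v) (r v) (g v) p (k v) (l v)) :
    R.IsSubbundle fun v => AdaptedFrame.saturatedImage (A v) :=
  Rep.isSubbundle_of_fibre_eq_satFibre (fun _ => rfl)
    (fun v p t => range_le_comap_range_of_comm (hg.comm_φ v p t))
    (fun a p => range_le_comap_range_of_comm (hg.comm_x a p))
    fun a p t => range_le_comap_range_of_comm (hg.comm_y a p t)

theorem IsMorphism.sub_smul_id [∀ v, ContMDiffVectorBundle ω (Fin (r v) → ℂ) (E v) 𝓘(ℂ, ℂ)]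
    (hg : IsMorphism R R g) (c : ℂ) :
    IsMorphism R R (fun v p => g v p - c • (LinearMap.id : E v p →ₗ[ℂ] E v p)) where
  holomorphic v := (hg.holomorphic v).sub_smul_id c
  comm_φ v p t := by
    rw [LinearMap.sub_comp, LinearMap.comp_sub, hg.comm_φ, LinearMap.smul_comp,
      LinearMap.comp_smul, LinearMap.id_comp, LinearMap.comp_id]
  comm_x a p := by
    rw [LinearMap.sub_comp, LinearMap.comp_sub, hg.comm_x, LinearMap.smul_comp,
      LinearMap.comp_smul, LinearMap.id_comp, LinearMap.comp_id]
  comm_y a p t := by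
    rw [LinearMap.sub_comp, LinearMap.comp_sub, hg.comm_y, LinearMap.smul_comp,
      LinearMap.comp_smul, LinearMap.id_comp, LinearMap.comp_id]

end Subbundle

variable [∀ v, VectorBundle ℂ (Fin (r v) → ℂ) (E v)]
  [∀ v, ContMDiffVectorBundle ω (Fin (r v) → ℂ) (E v) 𝓘(ℂ, ℂ)]
  [Fintype V] [CompactSpace X] [T2Space X] {σ τ : V → ℝ}

theorem slope_whole_le_max_slope (hσ : ∀ v, 0 ≤ σ v)
    {S I : ∀ v, HolomorphicSubbundle (r v) (E v)} (hrank : ∀ v, r v = (S v).rank + (I v).rank)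
    (hdeg : ∀ v, (HolomorphicSubbundle.whole (r v) (E v)).degree ≤ (S v).degree + (I v).degree)
    (hS : ∃ v, (S v).rank ≠ 0) (hI : ∃ v, (I v).rank ≠ 0) :
    slope σ τ (fun v => HolomorphicSubbundle.whole (r v) (E v)) ≤
      max (slope σ τ S) (slope σ τ I) := by
  have sum_rank_pos {S : ∀ v, HolomorphicSubbundle (r v) (E v)} (h : ∃ v, (S v).rank ≠ 0) :
      0 < ∑ v, ((S v).rank : ℝ) :=
    Finset.sum_pos' (fun _ _ => Nat.cast_nonneg _)
      (h.imp fun v hv => ⟨Finset.mem_univ v, Nat.cast_pos.2 (Nat.pos_of_ne_zero hv)⟩)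
  have rank_whole (v : V) : ((HolomorphicSubbundle.whole (r v) (E v)).rank : ℝ) =
      (S v).rank + (I v).rank := by
    rw [← Nat.cast_add, ← hrank]
    rfl
  refine le_trans ?_ (add_div_add_le_max_div (sum_rank_pos hS) (sum_rank_pos hI))
  simp only [slope, rank_whole, mul_add, Finset.sum_add_distrib]
  refine div_le_div_of_nonneg_right ?_ (add_pos (sum_rank_pos hS) (sum_rank_pos hI)).le
  have sum_degree_le := Finset.sum_le_sum fun v (_ : v ∈ Finset.univ) =>
    mul_le_mul_of_nonneg_left (hdeg v) (hσ v)
  simp only [mul_add, Finset.sum_add_distrib] at sum_degree_le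
  linarith

theorem Rep.IsStable.eq_zero_of_forall_ker_ne_bot [ConnectedSpace X] [Quiver V] {R : Rep r E}
    (hσ : ∀ v, 0 ≤ σ v) (hR : R.IsStable σ τ) {g : ∀ v, FibreMap (E v) (E v)}
    (hg : IsMorphism R R g) {v₀ : V} (hker : ∀ p, LinearMap.ker (g v₀ p) ≠ ⊥) (v : V) (p : X) :
    g v p = 0 := by
  by_contra hgp
  choose k l hA using fun v => exists_forall_adaptedFrame (hg.holomorphic v)
  let A (v : V) (p : X) : AdaptedFrame (r v) (r v) (g v) p (k v) (l v) := (hA v p).some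
  have rank_add (v : V) : k v + l v = r v := (A v p).rank_add
  have hl : l v₀ ≠ 0 := (A v₀ p).rank_ker_ne_zero hker
  have hk : k v ≠ 0 := (A v p).rank_range_ne_zero (A v p).mem hgp
  let S (v : V) := AdaptedFrame.saturatedKernel (A v)
  let I (v : V) := AdaptedFrame.saturatedImage (A v)
  have slope_ker := hR S (hg.isSubbundle_saturatedKernel A) ⟨v₀, p, (S v₀).fibre_ne_bot hl p⟩
    ⟨v, p, (S v).fibre_ne_top (fun h : l v = r v => hk (by have := rank_add v; lia)) p⟩
  have slope_im := hR I (hg.isSubbundle_saturatedImage A) ⟨v, p, (I v).fibre_ne_bot hk p⟩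
    ⟨v₀, p, (I v₀).fibre_ne_top (fun h : k v₀ = r v₀ => hl (by have := rank_add v₀; lia)) p⟩
  refine (max_lt slope_ker slope_im).not_ge (slope_whole_le_max_slope hσ
    (fun v => ?_) (fun v => AdaptedFrame.degree_whole_le (hg.holomorphic v) (A v)) ⟨v₀, hl⟩ ⟨v, hk⟩)
  exact (rank_add v).symm.trans (add_comm _ _)

end Quiver

end QbarBundle

end

theorem mainTheorem4 {X : Type*} [TopologicalSpace X] [ChartedSpace ℂ X]
    [IsManifold 𝓘(ℂ, ℂ) ω X] [CompactSpace X] [T2Space X] [ConnectedSpace X]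
    {V : Type*} [Fintype V] [Quiver V]
    {r : V → ℕ} {E : V → X → Type*}
    [∀ v p, AddCommGroup (E v p)] [∀ v p, Module ℂ (E v p)] [∀ v p, TopologicalSpace (E v p)]
    [∀ v, TopologicalSpace (TotalSpace (Fin (r v) → ℂ) (E v))]
    [∀ v, FiberBundle (Fin (r v) → ℂ) (E v)]
    [∀ v, VectorBundle ℂ (Fin (r v) → ℂ) (E v)]
    [∀ v, ContMDiffVectorBundle ω (Fin (r v) → ℂ) (E v) 𝓘(ℂ, ℂ)]
    (R : QbarBundle.Rep r E) (σ τ : V → ℝ) (hσ : ∀ v, 0 < σ v) (hR : R.IsStable σ τ) :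
    R.IsSimple := by
  intro f hf
  by_cases hr : ∃ v, r v ≠ 0
  · obtain ⟨v₀, hv₀⟩ := hr
    obtain ⟨c, hc⟩ := (hf.holomorphic v₀).exists_forall_hasEigenvalue hv₀
    have hker (p : X) : LinearMap.ker (f v₀ p - c • LinearMap.id) ≠ ⊥ := by
      simpa only [Module.End.hasEigenvalue_iff, Module.End.eigenspace_def, Module.End.one_eq_id]
        using hc p
    exact ⟨c, fun v p => sub_eq_zero.1 (hR.eq_zero_of_forall_ker_ne_bot (fun v => (hσ v).le)
      (hf.sub_smul_id c) hker v p)⟩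
  · push Not at hr
    refine ⟨0, fun v p => LinearMap.ext fun x => ?_⟩
    have : Subsingleton (E v p) :=
      (QbarBundle.fibreEquiv (r v) (E v) p).toEquiv.subsingleton_congr.2 <| by
        rw [hr v]
        infer_instance
    exact Subsingleton.elim _ _
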